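/- **Setting.** Let $\Gamma=\{(\xi,\eta)\in[0,1]^2:\xi+\eta\le 1\}$ with vertices $v_1=(0,0)$, $v_2=(0,1)$, $v_3=(1,0)$ and edges $e_{12},e_{13},e_{23}$, $\mathcal J=\{(1,2),(1,3),(2,3)\}$. Let $\tau_{ij}=v_j-v_i$ be the edge tangents, i.e. $\tau_{12}=\mathbf e_2$, $\tau_{13}=\mathbf e_1$, $\tau_{23}=\mathbf e_1-\mathbf e_2$. Let $p\ge 1$ and let $U^p$ be spanned by linearly independent bivariate real polynomials: one vertex function for each $v_i$ (set $\mathcal V_i$), $p-1$ edge functions for each $e_j$, $j\in\mathcal J$ (set $\mathcal E_j$), and $(p-2)(p-1)/2$ cell functions (set $\mathcal C_{123}$). A vertex function vanishes at the other vertices and on the opposite edge, an edge function on the other two edges, and a cell function on $\partial\Gamma$. The template consists of $$\mathcal T_1=\{\mathbf e_1,\mathbf e_2\},\quad \mathcal T_2=\{\mathbf e_1+\mathbf e_2,\mathbf e_1\},\quad \mathcal T_3=\{\mathbf e_1+\mathbf e_2,-\mathbf e_2\},$$ $$\mathcal T_{12}=\{\mathbf e_2,-\mathbf e_1\},\quad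 \mathcal T_{13}=\{\mathbf e_1,\mathbf e_2\},\quad \mathcal T_{23}=\{\tfrac12(\mathbf e_1-\mathbf e_2),\mathbf e_1+\mathbf e_2\},\quad \mathcal T_{123}=\{\mathbf e_1,\mathbf e_2\}.$$ The non-cell base functions of $\mathcal N_{II}^p$ on the edge $e_{ij}$ are $\vartheta=n\,\ell$ with $n\in\mathcal V_i,\ \ell\in\mathcal T_i$, or $n\in\mathcal V_j,\ \ell\in\mathcal T_j$, or $n\in\mathcal E_{ij},\ \ell\in\mathcal T_{ij}$, where in each case $\langle\tau_{ij},\ell\rangle\ne0$. The cell base functions are $n\,\ell$ with $n\in\mathcal E_{ij},\ \ell\in\mathcal T_{ij},\ \langle\tau_{ij},\ell\rangle=0$, or $n\in\mathcal C_{123},\ \ell\in\mathcal T_{123}$. An element map is a map $x$ that is $C^1$ up to the boundary of $\Gamma$ (i.e. $C^1$ near each point of $\Gamma$), injective on $\Gamma$, with Jacobian $J$ invertible on $\Gamma$ (for example an affine map onto a nondegenerate triangle). The covariant Piola transform of $\vartheta$ is $\theta(x(\xi))=J(\xi)^{-T}\vartheta(\xi)$. A triangulation of an open set $A\subset\mathbb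 R^2$ is a finite family of element maps $x_T$ whose images cover exactly $\overline A$, together with globally numbered vertices, different elements having different vertex sets. The images meet exactly in the common vertices and edges, where the maps agree in terms of barycentric coordinates, and the local vertex order in every element is increasing in the global numbering. Assembled functions are arbitrary linear combinations in which the coefficients of vertex functions (scalar case), of vertex-edge functions (vectorial case) and of edge functions (both cases) are shared by all elements containing the vertex or edge in question, and all other coefficients are free in each element; scalar functions are mapped by $u(x_T(\xi))=n(\xi)$ and vectorial ones by the covariant Piola transformation. The basis of $U^p$ is called $H^1$-conforming if, on every triangulation of every open set $A$, all assembled scalar functions lie in $H^1(A)$. **Theorem.** Suppose that the basis of $U^p$ is $H^1$-conforming. Then: 1. If $\vartheta=n\,\ell$ is a non-cell base function on the edge $e_{ij}$, then $\langle\tau_{ij},\vartheta\rangle=n$ on $e_{ij}$, and the tangential trace of $\vartheta$ vanishes on the other two edges. If $\vartheta$ is a cell base function, its tangential trace vanishes on all edges. The same holds in the physical domain: for every element map $x$, these identities hold with $\theta$ in place of $\vartheta$ and the edge tangent $J\tau$ in place of $\tau$, that is, $\langle J\tau_{ij},\theta\circ x\rangle=n$ on $e_{ij}$, and so on. 2.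 On every triangulation, the tangential traces from both sides of any assembled Piola-mapped function agree at every point of an edge shared by two elements. 3. The element is $H(\mathrm{curl})$-conforming under covariant Piola transformations: on every triangulation of every open set $A$, all assembled Piola-mapped functions lie in $H(\mathrm{curl},A)$, i.e. in $[L^2(A)]^2$ with weak rotation $\partial_1u_2-\partial_2u_1\in L^2(A)$. -/

import Mathlib

open scoped ContDiff

noncomputable section

namespace TriNedelec

/-- The Euclidean plane. -/
abbrev Plane : Type := EuclideanSpace ℝ (Fin 2)

/-! ### Weak derivatives and the spaces `H¹(A)` and `H(curl, A)` in the plane -/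

/-- Real test functions: smooth with compact support contained in `A`. -/
def IsTestFn (A : Set Plane) (φ : Plane → ℝ) : Prop :=
  ContDiff ℝ ∞ φ ∧ HasCompactSupport φ ∧ tsupport φ ⊆ A

/-- The partial derivative of `φ` in the `i`-th coordinate direction. -/
def partialD (i : Fin 2) (φ : Plane → ℝ) (x : Plane) : ℝ :=
  fderiv ℝ φ x (EuclideanSpace.single i 1)

/-- `u ∈ H¹(A)`: `u ∈ L²(A)` and its weak gradient exists and lies in `[L²(A)]²`. -/
def MemH1 (A : Set Plane) (u : Plane → ℝ) : Prop :=
  MeasureTheory.MemLp u 2 (MeasureTheory.volume.restrict A) ∧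
  ∃ g : Fin 2 → Plane → ℝ, ∀ i, MeasureTheory.MemLp (g i) 2 (MeasureTheory.volume.restrict A) ∧
    ∀ φ, IsTestFn A φ → ∫ x in A, u x * partialD i φ x = - ∫ x in A, g i x * φ x

/-- `u ∈ H(curl, A)`: `u ∈ [L²(A)]²` and its weak rotation `∂₁ u₂ - ∂₂ u₁` exists and lies in
`L²(A)`. -/
def MemHcurl (A : Set Plane) (u : Plane → Plane) : Prop :=
  MeasureTheory.MemLp u 2 (MeasureTheory.volume.restrict A) ∧
  ∃ g : Plane → ℝ, MeasureTheory.MemLp g 2 (MeasureTheory.volume.restrict A) ∧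
    ∀ φ, IsTestFn A φ →
      ∫ x in A, (u x 0 * partialD 1 φ x - u x 1 * partialD 0 φ x) = ∫ x in A, g x * φ x

/-! ### The reference triangle -/

/-- The first Cartesian base vector. -/
def e₁ : Plane := !₂[1, 0]

/-- The second Cartesian base vector. -/
def e₂ : Plane := !₂[0, 1]

/-- The (closed) reference triangle `Γ = {(ξ, η) ∈ [0,1]² | ξ + η ≤ 1}`. -/
def refTriangle : Set Plane :=
  {ξ | ξ 0 ∈ Set.Icc (0 : ℝ) 1 ∧ ξ 1 ∈ Set.Icc (0 : ℝ) 1 ∧ ξ 0 + ξ 1 ≤ 1}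

/-- The vertices `v₁ = (0,0)`, `v₂ = (0,1)`, `v₃ = (1,0)` (indices shifted to `0, 1, 2`). -/
def refVertex : Fin 3 → Plane := ![0, e₂, e₁]

/-- The barycentric coordinates with respect to `v₁, v₂, v₃`. -/
def refBary (a : Fin 3) (ξ : Plane) : ℝ := ![1 - ξ 0 - ξ 1, ξ 1, ξ 0] a

/-- The edges `e₁₂, e₁₃, e₂₃` are numbered `0, 1, 2`; this is the first vertex of an edge. -/
def edgeFst : Fin 3 → Fin 3 := ![0, 0, 1]

/-- The second vertex of an edge. -/
def edgeSnd : Fin 3 → Fin 3 := ![1, 2, 2]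

/-- The closed edge `e`. -/
def refEdge (e : Fin 3) : Set Plane :=
  segment ℝ (refVertex (edgeFst e)) (refVertex (edgeSnd e))

/-- The tangent vector of the edge `e_{ij}`, `i < j`, pointing from `v_i` to `v_j`
and having the length of the edge: `e₂`, `e₁` and `e₁ - e₂`. -/
def refTangent (e : Fin 3) : Plane := refVertex (edgeSnd e) - refVertex (edgeFst e)

/-! ### The underlying scalar basis -/

/-- The value of a bivariate polynomial at a point of the plane. -/
def polyEval (q : MvPolynomial (Fin 2) ℝ) (ξ : Plane) : ℝ := MvPolynomial.eval (fun i => ξ i) q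

/-- A polytopal polynomial basis of a space `U^p(Γ)` with
`dim U^p(Γ) = dim P^p(Γ) = (p+2)(p+1)/2`: one function for each vertex, `p-1` for each edge and
`(p-2)(p-1)/2` for the cell. -/
structure PolytopalBasis (p : ℕ) where
  vertexFn : Fin 3 → MvPolynomial (Fin 2) ℝ
  edgeFn : Fin 3 → Fin (p - 1) → MvPolynomial (Fin 2) ℝ
  cellFn : Fin ((p - 2) * (p - 1) / 2) → MvPolynomial (Fin 2) ℝ
  linearIndependent : LinearIndependent ℝ
    (Sum.elim vertexFn (Sum.elim (fun q : Fin 3 × Fin (p - 1) => edgeFn q.1 q.2) cellFn))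
  /-- A vertex base function vanishes at the other vertices ... -/
  vertexFn_vertex : ∀ i j, j ≠ i → polyEval (vertexFn i) (refVertex j) = 0
  /-- ... and on the edge that does not contain the vertex. -/
  vertexFn_edge : ∀ i e, edgeFst e ≠ i → edgeSnd e ≠ i →
    ∀ ξ ∈ refEdge e, polyEval (vertexFn i) ξ = 0
  /-- An edge base function vanishes on the other edges. -/
  edgeFn_edge : ∀ e k e', e' ≠ e → ∀ ξ ∈ refEdge e', polyEval (edgeFn e k) ξ = 0
  /-- A cell base function vanishes on the boundary. -/
  cellFn_edge : ∀ k e, ∀ ξ ∈ refEdge e, polyEval (cellFn k) ξ = 0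

/-! ### The template and the vectorial base functions on the reference triangle -/

open Classical in
/-- The template sets `𝒯₁, 𝒯₂, 𝒯₃` of the vertices. -/
def vertexTemplate : Fin 3 → Finset Plane :=
  ![{e₁, e₂}, {e₁ + e₂, e₁}, {e₁ + e₂, -e₂}]

open Classical in
/-- The template sets `𝒯₁₂, 𝒯₁₃, 𝒯₂₃` of the edges. -/
def edgeTemplate : Fin 3 → Finset Plane :=
  ![{e₂, -e₁}, {e₁, e₂}, {(1 / 2 : ℝ) • (e₁ - e₂), e₁ + e₂}]

open Classical in
/-- The template set `𝒯₁₂₃` of the cell. -/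
def cellTemplate : Finset Plane := {e₁, e₂}

open Classical in
/-- The vectors of a template set whose tangential trace on the edge `e` does not vanish. -/
def tangentialPart (S : Finset Plane) (e : Fin 3) : Finset Plane :=
  S.filter fun l => inner ℝ (refTangent e) l ≠ 0

open Classical in
/-- The vectors of a template set whose tangential trace on the edge `e` vanishes. -/
def normalPart (S : Finset Plane) (e : Fin 3) : Finset Plane :=
  S.filter fun l => inner ℝ (refTangent e) l = 0

/-- `IsNonCellFn B e n ϑ`: `ϑ` is a non-cell (vertex-edge or edge) base function of the triangle
Nédélec element of the second type on the edge `e`, and `n` is the scalar base function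
from which it is built. -/
inductive IsNonCellFn {p : ℕ} (B : PolytopalBasis p) :
    Fin 3 → MvPolynomial (Fin 2) ℝ → (Plane → Plane) → Prop
  | vertexEdgeFst (e : Fin 3) (l : Plane)
      (hl : l ∈ tangentialPart (vertexTemplate (edgeFst e)) e) :
      IsNonCellFn B e (B.vertexFn (edgeFst e)) (fun ξ => polyEval (B.vertexFn (edgeFst e)) ξ • l)
  | vertexEdgeSnd (e : Fin 3) (l : Plane)
      (hl : l ∈ tangentialPart (vertexTemplate (edgeSnd e)) e) :
      IsNonCellFn B e (B.vertexFn (edgeSnd e)) (fun ξ => polyEval (B.vertexFn (edgeSnd e)) ξ • l)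
  | edge (e : Fin 3) (k : Fin (p - 1)) (l : Plane) (hl : l ∈ tangentialPart (edgeTemplate e) e) :
      IsNonCellFn B e (B.edgeFn e k) (fun ξ => polyEval (B.edgeFn e k) ξ • l)

/-- `IsCellFn B ϑ`: `ϑ` is a cell (edge-cell or pure cell) base function of the triangle
Nédélec element of the second type. -/
inductive IsCellFn {p : ℕ} (B : PolytopalBasis p) : (Plane → Plane) → Prop
  | edgeCell (e : Fin 3) (k : Fin (p - 1)) (l : Plane) (hl : l ∈ normalPart (edgeTemplate e) e) :
      IsCellFn B (fun ξ => polyEval (B.edgeFn e k) ξ • l)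
  | cell (k : Fin ((p - 2) * (p - 1) / 2)) (l : Plane) (hl : l ∈ cellTemplate) :
      IsCellFn B (fun ξ => polyEval (B.cellFn k) ξ • l)

/-! ### Element maps and triangulations -/

/-- Element maps: `C¹` up to the boundary of `Γ`, injective, with invertible Jacobian. Affine
(barycentric) maps onto nondegenerate triangles are examples. -/
structure IsElementMap (x : Plane → Plane) : Prop where
  contDiffAt : ∀ ξ ∈ refTriangle, ContDiffAt ℝ 1 x ξ
  injOn : Set.InjOn x refTriangle
  det_ne_zero : ∀ ξ ∈ refTriangle, (fderiv ℝ x ξ).det ≠ 0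

/-- The covariant Piola transformation: the value at the physical point `x ξ` of the field
`θ = J^{-T} ϑ`, where `J` is the Jacobian of the element map `x`. -/
def covariantPiola (x : Plane → Plane) (ϑ : Plane → Plane) (ξ : Plane) : Plane :=
  (ContinuousLinearMap.adjoint (fderiv ℝ x ξ)).inverse (ϑ ξ)

/-- The tangent vector `J τ` of the physical edge `x(e)` at the point `x ξ`. -/
def physTangent (x : Plane → Plane) (e : Fin 3) (ξ : Plane) : Plane :=
  fderiv ℝ x ξ (refTangent e)

/-- The barycentric coordinates of `ξ`, regarded as a function on the global vertex
numbers, where `s` lists the numbers of the three vertices of an element. -/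
def globalBary (s : Fin 3 → ℕ) (ξ : Plane) (v : ℕ) : ℝ :=
  ∑ a, if s a = v then refBary a ξ else 0

/-- A conforming triangulation, with possibly curved elements, of an open set `A`.
The vertices carry global numbers, and the local numbering in each element is increasing, so
that neighbouring elements induce the same orientation on a common edge. -/
structure Triangulation (A : Set Plane) where
  isOpen : IsOpen A
  /-- the number of elements -/
  m : ℕ
  /-- the global numbers of the vertices of an element -/
  vtx : Fin m → Fin 3 → ℕ
  /-- the maps from the reference triangle onto the elements -/
  map : Fin m → Plane → Plane
  isElementMap : ∀ T, IsElementMap (map T)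
  vtx_strictMono : ∀ T, StrictMono (vtx T)
  /-- different elements have different vertex sets -/
  vtx_injective : Function.Injective vtx
  /-- Elements meet exactly in their common vertices and edges, and their maps agree there. -/
  conforming : ∀ T T', ∀ ξ ∈ refTriangle, ∀ ξ' ∈ refTriangle,
    (map T ξ = map T' ξ' ↔ globalBary (vtx T) ξ = globalBary (vtx T') ξ')
  covers : ⋃ T, map T '' refTriangle = closure A

/-! ### Assembled finite element functions and conformity -/

/-- Coefficients of a scalar finite element function: one for each vertex,
`p-1` for each edge (given by its two vertices in increasing order), and the rest for each cell. -/
structure ScalarCoeffs (p m : ℕ) where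
  vertex : ℕ → ℝ
  edge : ℕ → ℕ → Fin (p - 1) → ℝ
  cell : Fin m → Fin ((p - 2) * (p - 1) / 2) → ℝ

/-- The scalar finite element function on the element `T`, in reference coordinates. -/
def ScalarCoeffs.onElement {p : ℕ} {A : Set Plane} (B : PolytopalBasis p) (M : Triangulation A)
    (c : ScalarCoeffs p M.m) (T : Fin M.m) (ξ : Plane) : ℝ :=
  ∑ i, c.vertex (M.vtx T i) * polyEval (B.vertexFn i) ξ
    + ∑ e, ∑ k, c.edge (M.vtx T (edgeFst e)) (M.vtx T (edgeSnd e)) k * polyEval (B.edgeFn e k) ξ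
    + ∑ k, c.cell T k * polyEval (B.cellFn k) ξ

/-- `U^p` is `H¹`-conforming: on every triangulation, all assembled functions
(arbitrary on the interfaces, a null set) belong to `H¹(A)`. -/
def IsH1Conforming {p : ℕ} (B : PolytopalBasis p) : Prop :=
  ∀ (A : Set Plane) (M : Triangulation A) (c : ScalarCoeffs p M.m) (u : Plane → ℝ),
    (∀ T, ∀ ξ ∈ interior refTriangle, u (M.map T ξ) = c.onElement B M T ξ) → MemH1 A u

/-- Coefficients of a vectorial finite element function. A vertex-edge coefficient `vertexEdge v w`
belongs to the vertex `v` of the edge with vertices `v` and `w`. Coefficients of vertex-edge and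
edge functions are shared by the elements containing the edge; those of edge-cell and cell
functions are free in each element (and for each template vector). -/
structure NedelecCoeffs (p m : ℕ) where
  vertexEdge : ℕ → ℕ → ℝ
  edge : ℕ → ℕ → Fin (p - 1) → ℝ
  edgeCell : Fin m → Fin 3 → Fin (p - 1) → Plane → ℝ
  cell : Fin m → Fin ((p - 2) * (p - 1) / 2) → Plane → ℝ

/-- The vectorial finite element function on the element `T`, in reference coordinates, before the
Piola transformation. -/
def NedelecCoeffs.onElement {p : ℕ} {A : Set Plane} (B : PolytopalBasis p) (M : Triangulation A)
    (c : NedelecCoeffs p M.m) (T : Fin M.m) (ξ : Plane) : Plane :=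
  ∑ e,
    (∑ l ∈ tangentialPart (vertexTemplate (edgeFst e)) e,
        (c.vertexEdge (M.vtx T (edgeFst e)) (M.vtx T (edgeSnd e)) *
          polyEval (B.vertexFn (edgeFst e)) ξ) • l
      + ∑ l ∈ tangentialPart (vertexTemplate (edgeSnd e)) e,
        (c.vertexEdge (M.vtx T (edgeSnd e)) (M.vtx T (edgeFst e)) *
          polyEval (B.vertexFn (edgeSnd e)) ξ) • l
      + ∑ k, ∑ l ∈ tangentialPart (edgeTemplate e) e,
        (c.edge (M.vtx T (edgeFst e)) (M.vtx T (edgeSnd e)) k * polyEval (B.edgeFn e k) ξ) • l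
      + ∑ k, ∑ l ∈ normalPart (edgeTemplate e) e,
        (c.edgeCell T e k l * polyEval (B.edgeFn e k) ξ) • l)
    + ∑ k, ∑ l ∈ cellTemplate, (c.cell T k l * polyEval (B.cellFn k) ξ) • l

/-- The Nédélec element of the second type built from `B` is `H(curl)`-conforming under
covariant Piola transformations: on every triangulation, all assembled Piola-mapped functions
(arbitrary on the interfaces, a null set) belong to `H(curl, A)`. -/
def IsHcurlConforming {p : ℕ} (B : PolytopalBasis p) : Prop :=
  ∀ (A : Set Plane) (M : Triangulation A) (c : NedelecCoeffs p M.m) (θ : Plane → Plane),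
    (∀ T, ∀ ξ ∈ interior refTriangle,
      θ (M.map T ξ) = covariantPiola (M.map T) (c.onElement B M T) ξ) → MemHcurl A θ

/-- The jumps of the tangential traces of all assembled Piola-mapped functions vanish: at
a point `x_T(ξ) = x_{T'}(ξ')` of an edge shared by `T` and `T'`, the tangential components of the
boundary values from both sides, along the same tangent vector of the edge, agree. -/
def HasContinuousTangentialTrace {p : ℕ} (B : PolytopalBasis p) : Prop :=
  ∀ (A : Set Plane) (M : Triangulation A) (c : NedelecCoeffs p M.m) (T T' : Fin M.m)
    (e e' : Fin 3),
    M.vtx T (edgeFst e) = M.vtx T' (edgeFst e') →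
    M.vtx T (edgeSnd e) = M.vtx T' (edgeSnd e') →
    ∀ ξ ∈ refEdge e, ∀ ξ' ∈ refEdge e', M.map T ξ = M.map T' ξ' →
      inner ℝ (physTangent (M.map T) e ξ) (covariantPiola (M.map T) (c.onElement B M T) ξ) =
      inner ℝ (physTangent (M.map T) e ξ) (covariantPiola (M.map T') (c.onElement B M T') ξ')

end TriNedelec

end

namespace TriNedelec

theorem inner_plane (u v : Plane) : inner ℝ u v = u 0 * v 0 + u 1 * v 1 := by
  rw [PiLp.inner_apply, Fin.sum_univ_two]
  simp [mul_comm]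

theorem e₁_zero : e₁ 0 = 1 := by simp [e₁]
theorem e₁_one : e₁ 1 = 0 := by simp [e₁]
theorem e₂_zero : e₂ 0 = 0 := by simp [e₂]
theorem e₂_one : e₂ 1 = 1 := by simp [e₂]

theorem plane_ext {u v : Plane} (h0 : u 0 = v 0) (h1 : u 1 = v 1) : u = v := by
  ext i; fin_cases i <;> assumption

/-- The vector of the template of the first vertex of an edge that is tangential to the edge. -/
noncomputable def fstVec : Fin 3 → Plane := ![e₂, e₁, e₁]

/-- The vector of the template of the second vertex of an edge that is tangential to the edge. -/
noncomputable def sndVec : Fin 3 → Plane := ![e₁ + e₂, e₁ + e₂, -e₂]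

/-- The vector of the template of an edge that is tangential to the edge. -/
noncomputable def edgeVec : Fin 3 → Plane := ![e₂, e₁, (1 / 2 : ℝ) • (e₁ - e₂)]

theorem tangentialPart_fst (e : Fin 3) :
    tangentialPart (vertexTemplate (edgeFst e)) e = {fstVec e} := by
  classical
  fin_cases e <;>
    simp [tangentialPart, vertexTemplate, edgeFst, fstVec, refTangent, refVertex, edgeSnd,
      Finset.filter_insert, Finset.filter_singleton, inner_plane, e₁_zero, e₁_one, e₂_zero, e₂_one]

theorem tangentialPart_snd (e : Fin 3) :
    tangentialPart (vertexTemplate (edgeSnd e)) e = {sndVec e} := by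
  classical
  fin_cases e <;>
    simp [tangentialPart, vertexTemplate, edgeFst, sndVec, refTangent, refVertex, edgeSnd,
      Finset.filter_insert, Finset.filter_singleton, inner_plane, e₁_zero, e₁_one, e₂_zero, e₂_one]

theorem tangentialPart_edge (e : Fin 3) :
    tangentialPart (edgeTemplate e) e = {edgeVec e} := by
  classical
  fin_cases e <;>
    simp [tangentialPart, edgeTemplate, edgeFst, edgeVec, refTangent, refVertex, edgeSnd,
      Finset.filter_insert, Finset.filter_singleton, inner_plane, e₁_zero, e₁_one, e₂_zero, e₂_one]

theorem inner_refTangent_fstVec (e : Fin 3) : inner ℝ (refTangent e) (fstVec e) = 1 := by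
  rw [inner_plane]
  fin_cases e <;> simp [fstVec, refTangent, refVertex, edgeSnd, edgeFst,
    e₁_zero, e₁_one, e₂_zero, e₂_one]

theorem inner_refTangent_sndVec (e : Fin 3) : inner ℝ (refTangent e) (sndVec e) = 1 := by
  fin_cases e <;> simp [sndVec, refTangent, refVertex, edgeSnd, edgeFst, inner_plane,
    e₁_zero, e₁_one, e₂_zero, e₂_one]

theorem inner_refTangent_edgeVec (e : Fin 3) : inner ℝ (refTangent e) (edgeVec e) = 1 := by
  rw [inner_plane]
  fin_cases e <;> simp [edgeVec, refTangent, refVertex, edgeSnd, edgeFst,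
    e₁_zero, e₁_one, e₂_zero, e₂_one]
  norm_num

theorem inner_refTangent_fstVec_of_mem (e e' : Fin 3) (h : e' ≠ e)
    (hm : edgeFst e' = edgeFst e ∨ edgeSnd e' = edgeFst e) :
    inner ℝ (refTangent e') (fstVec e) = 0 := by
  fin_cases e <;> fin_cases e' <;>
    simp_all [fstVec, refTangent, refVertex, edgeSnd, edgeFst, inner_plane,
    e₁_zero, e₁_one, e₂_zero, e₂_one]

theorem inner_refTangent_sndVec_of_mem (e e' : Fin 3) (h : e' ≠ e)
    (hm : edgeFst e' = edgeSnd e ∨ edgeSnd e' = edgeSnd e) :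
    inner ℝ (refTangent e') (sndVec e) = 0 := by
  fin_cases e <;> fin_cases e' <;>
    simp_all [sndVec, refTangent, refVertex, edgeSnd, edgeFst, inner_plane,
    e₁_zero, e₁_one, e₂_zero, e₂_one]

variable {p : ℕ} {B : PolytopalBasis p}

theorem IsNonCellFn.inner_own {e : Fin 3} {n ϑ} (h : IsNonCellFn B e n ϑ) (ξ : Plane) :
    inner ℝ (refTangent e) (ϑ ξ) = polyEval n ξ := by
  cases h with
  | vertexEdgeFst l hl =>
    rw [tangentialPart_fst, Finset.mem_singleton] at hl
    simp [inner_smul_right, hl, inner_refTangent_fstVec]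
  | vertexEdgeSnd l hl =>
    rw [tangentialPart_snd, Finset.mem_singleton] at hl
    simp [inner_smul_right, hl, inner_refTangent_sndVec]
  | edge k l hl =>
    rw [tangentialPart_edge, Finset.mem_singleton] at hl
    simp [inner_smul_right, hl, inner_refTangent_edgeVec]

theorem IsNonCellFn.inner_other {e : Fin 3} {n ϑ} (h : IsNonCellFn B e n ϑ) {e' : Fin 3}
    (he : e' ≠ e) {ξ : Plane} (hξ : ξ ∈ refEdge e') :
    inner ℝ (refTangent e') (ϑ ξ) = 0 := by
  cases h with
  | vertexEdgeFst l hl =>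
    rw [tangentialPart_fst, Finset.mem_singleton] at hl
    by_cases hm : edgeFst e' = edgeFst e ∨ edgeSnd e' = edgeFst e
    · simp [inner_smul_right, hl, inner_refTangent_fstVec_of_mem e e' he hm]
    · rw [not_or] at hm
      simp [B.vertexFn_edge _ _ hm.1 hm.2 ξ hξ]
  | vertexEdgeSnd l hl =>
    rw [tangentialPart_snd, Finset.mem_singleton] at hl
    by_cases hm : edgeFst e' = edgeSnd e ∨ edgeSnd e' = edgeSnd e
    · simp [inner_smul_right, hl, inner_refTangent_sndVec_of_mem e e' he hm]
    · rw [not_or] at hm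
      simp [B.vertexFn_edge _ _ hm.1 hm.2 ξ hξ]
  | edge k l hl =>
    simp [B.edgeFn_edge e k e' he ξ hξ]

theorem IsCellFn.inner_eq_zero {ϑ} (h : IsCellFn B ϑ) (e : Fin 3) {ξ : Plane}
    (hξ : ξ ∈ refEdge e) : inner ℝ (refTangent e) (ϑ ξ) = 0 := by
  classical
  cases h with
  | edgeCell e' k l hl =>
    by_cases he : e = e'
    · subst he
      simp [inner_smul_right, (Finset.mem_filter.1 hl).2]
    · simp [B.edgeFn_edge e' k e he ξ hξ]
  | cell k l hl => simp [B.cellFn_edge k e ξ hξ]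

theorem inner_apply_adjoint_inverse {J : Plane →L[ℝ] Plane} (hJ : J.det ≠ 0) (u v : Plane) :
    inner ℝ (J u) ((ContinuousLinearMap.adjoint J).inverse v) = inner ℝ u v := by
  have hu : IsUnit J := by
    have h := (LinearMap.isUnit_iff_isUnit_det (J : Plane →ₗ[ℝ] Plane)).2
      (isUnit_iff_ne_zero.2 hJ)
    exact (ContinuousLinearMap.isUnit_iff_isUnit_toLinearMap (f := J)).2 h
  have ha : IsUnit (ContinuousLinearMap.adjoint J) := by
    simpa [ContinuousLinearMap.star_eq_adjoint] using hu.star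
  rw [← ContinuousLinearMap.adjoint_inner_right, ← ContinuousLinearMap.ringInverse_eq_inverse,
    ← mul_apply_eq_comp, Ring.mul_inverse_cancel _ ha]
  simp

/-- The parametrization of the edge `e` from its first to its second vertex. -/
noncomputable def edgeParam (e : Fin 3) (t : ℝ) : Plane := refVertex (edgeFst e) + t • refTangent e

theorem refEdge_eq_image (e : Fin 3) : refEdge e = edgeParam e '' Set.Icc 0 1 := by
  rw [refEdge, segment_eq_image']; rfl

theorem refBary_sum (ξ : Plane) : refBary 0 ξ + refBary 1 ξ + refBary 2 ξ = 1 := by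
  simp [refBary]

theorem mem_refTriangle_iff (ξ : Plane) : ξ ∈ refTriangle ↔ ∀ a, 0 ≤ refBary a ξ := by
  simp only [refTriangle, Set.mem_ofPred_eq, Set.mem_Icc, Fin.forall_fin_succ, refBary]
  simp
  constructor
  · rintro ⟨⟨_, _⟩, ⟨_, _⟩, _⟩; refine ⟨?_, ?_, ?_⟩ <;> linarith
  · rintro ⟨_, _, _⟩; refine ⟨⟨?_, ?_⟩, ⟨?_, ?_⟩, ?_⟩ <;> linarith

theorem refBary_fst_edgeParam (e : Fin 3) (t : ℝ) :
    refBary (edgeFst e) (edgeParam e t) = 1 - t := by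
  fin_cases e <;> simp [refBary, edgeParam, edgeFst, edgeSnd, refVertex, refTangent, e₁, e₂]
  ring

theorem refBary_snd_edgeParam (e : Fin 3) (t : ℝ) :
    refBary (edgeSnd e) (edgeParam e t) = t := by
  fin_cases e <;> simp [refBary, edgeParam, edgeFst, edgeSnd, refVertex, refTangent, e₁, e₂]

/-- The vertex opposite to an edge. -/
def edgeOpp : Fin 3 → Fin 3 := ![2, 1, 0]

theorem refBary_opp_edgeParam (e : Fin 3) (t : ℝ) :
    refBary (edgeOpp e) (edgeParam e t) = 0 := by
  fin_cases e <;> simp [refBary, edgeParam, edgeOpp, edgeFst, edgeSnd, refVertex, refTangent, e₁, e₂]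
  ring

theorem forall_vertex_iff (e : Fin 3) {P : Fin 3 → Prop} :
    (∀ a, P a) ↔ P (edgeFst e) ∧ P (edgeSnd e) ∧ P (edgeOpp e) := by
  fin_cases e <;> simp [Fin.forall_fin_succ, edgeFst, edgeSnd, edgeOpp] <;> tauto

theorem sum_vertex (e : Fin 3) (f : Fin 3 → ℝ) :
    ∑ a, f a = f (edgeFst e) + f (edgeSnd e) + f (edgeOpp e) := by
  fin_cases e <;> simp [Fin.sum_univ_three, edgeFst, edgeSnd, edgeOpp] <;> ring

theorem edgeParam_mem_refTriangle (e : Fin 3) {t : ℝ} (ht : t ∈ Set.Icc (0 : ℝ) 1) :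
    edgeParam e t ∈ refTriangle := by
  rw [mem_refTriangle_iff, forall_vertex_iff e, refBary_fst_edgeParam, refBary_snd_edgeParam,
    refBary_opp_edgeParam]
  exact ⟨by linarith [ht.2], ht.1, le_rfl⟩

theorem plane_ext_refBary {ξ ζ : Plane} (h : ∀ a, refBary a ξ = refBary a ζ) : ξ = ζ := by
  have h1 := h 1
  have h2 := h 2
  simp only [refBary, Matrix.cons_val] at h1 h2
  exact plane_ext h2 h1

theorem eq_edgeParam_of_refBary_opp (e : Fin 3) {ξ : Plane} (h : refBary (edgeOpp e) ξ = 0) :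
    ξ = edgeParam e (refBary (edgeSnd e) ξ) := by
  have hs := refBary_sum ξ
  have hs' := sum_vertex e fun a => refBary a ξ
  rw [Fin.sum_univ_three, hs] at hs'
  refine plane_ext_refBary ((forall_vertex_iff e).2 ⟨?_, ?_, ?_⟩)
  · rw [refBary_fst_edgeParam]; linarith
  · rw [refBary_snd_edgeParam]
  · rw [refBary_opp_edgeParam, h]

theorem IsElementMap.inner_physTangent {x : Plane → Plane} (hx : IsElementMap x) (e : Fin 3)
    (ϑ : Plane → Plane) {ξ : Plane} (hξ : ξ ∈ refTriangle) :
    inner ℝ (physTangent x e ξ) (covariantPiola x ϑ ξ) = inner ℝ (refTangent e) (ϑ ξ) :=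
  inner_apply_adjoint_inverse (hx.det_ne_zero ξ hξ) _ _

theorem refEdge_subset (e : Fin 3) : refEdge e ⊆ refTriangle := by
  rw [refEdge_eq_image]
  rintro _ ⟨t, ht, rfl⟩
  exact edgeParam_mem_refTriangle e ht

/-- The tangential trace of an assembled function on an edge of an element. -/
theorem inner_onElement {A : Set Plane} (M : Triangulation A)
    (c : NedelecCoeffs p M.m) (T : Fin M.m) (e : Fin 3) {ξ : Plane} (hξ : ξ ∈ refEdge e) :
    inner ℝ (refTangent e) (c.onElement B M T ξ) =
      c.vertexEdge (M.vtx T (edgeFst e)) (M.vtx T (edgeSnd e)) *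
          polyEval (B.vertexFn (edgeFst e)) ξ
      + c.vertexEdge (M.vtx T (edgeSnd e)) (M.vtx T (edgeFst e)) *
          polyEval (B.vertexFn (edgeSnd e)) ξ
      + ∑ k, c.edge (M.vtx T (edgeFst e)) (M.vtx T (edgeSnd e)) k *
          polyEval (B.edgeFn e k) ξ := by
  have hfst : ∀ e', polyEval (B.vertexFn (edgeFst e')) ξ * inner ℝ (refTangent e) (fstVec e') =
      if e' = e then polyEval (B.vertexFn (edgeFst e')) ξ else 0 := by
    intro e'
    have h := IsNonCellFn.vertexEdgeFst (B := B) e' (fstVec e') (by simp [tangentialPart_fst])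
    split_ifs with he
    · subst he; simpa [inner_smul_right] using h.inner_own ξ
    · simpa [inner_smul_right] using h.inner_other (Ne.symm he) hξ
  have hsnd : ∀ e', polyEval (B.vertexFn (edgeSnd e')) ξ * inner ℝ (refTangent e) (sndVec e') =
      if e' = e then polyEval (B.vertexFn (edgeSnd e')) ξ else 0 := by
    intro e'
    have h := IsNonCellFn.vertexEdgeSnd (B := B) e' (sndVec e') (by simp [tangentialPart_snd])
    split_ifs with he
    · subst he; simpa [inner_smul_right] using h.inner_own ξ
    · simpa [inner_smul_right] using h.inner_other (Ne.symm he) hξ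
  have hedge : ∀ e' k, polyEval (B.edgeFn e' k) ξ * inner ℝ (refTangent e) (edgeVec e') =
      if e' = e then polyEval (B.edgeFn e' k) ξ else 0 := by
    intro e' k
    have h := IsNonCellFn.edge (B := B) e' k (edgeVec e') (by simp [tangentialPart_edge])
    split_ifs with he
    · subst he; simpa [inner_smul_right] using h.inner_own ξ
    · simpa [inner_smul_right] using h.inner_other (Ne.symm he) hξ
  have hnormal : ∀ e' k, ∀ l ∈ normalPart (edgeTemplate e') e',
      polyEval (B.edgeFn e' k) ξ * inner ℝ (refTangent e) l = 0 := by
    intro e' k l hl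
    simpa [inner_smul_right] using (IsCellFn.edgeCell (B := B) e' k l hl).inner_eq_zero e hξ
  have hcell : ∀ k l, polyEval (B.cellFn k) ξ * inner ℝ (refTangent e) l = 0 := by
    intro k l
    simp [B.cellFn_edge k e ξ hξ]
  simp only [NedelecCoeffs.onElement, tangentialPart_fst, tangentialPart_snd, tangentialPart_edge,
    Finset.sum_singleton, inner_add_right, inner_sum, inner_smul_right, mul_assoc, hfst, hsnd,
    hedge, hcell, mul_zero, Finset.sum_const_zero, add_zero]
  have hn : ∀ e', ∑ k, ∑ l ∈ normalPart (edgeTemplate e') e', c.edgeCell T e' k l *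
      (polyEval (B.edgeFn e' k) ξ * inner ℝ (refTangent e) l) = 0 := fun e' =>
    Finset.sum_eq_zero fun k _ => Finset.sum_eq_zero fun l hl => by
      rw [hnormal e' k l hl, mul_zero]
  simp only [hn, add_zero, Finset.sum_add_distrib, mul_ite, mul_zero]
  rw [Finset.sum_comm (s := Finset.univ (α := Fin 3))]
  simp

end TriNedelec

namespace TriNedelec
open MeasureTheory Set

theorem measurePreserving_toPlane :
    MeasurePreserving (fun z : ℝ × ℝ => (!₂[z.1, z.2] : Plane)) :=
  (PiLp.volume_preserving_toLp (Fin 2)).comp (volume_preserving_finTwoArrow ℝ).symm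

theorem measurableEmbedding_toPlane :
    MeasurableEmbedding (fun z : ℝ × ℝ => (!₂[z.1, z.2] : Plane)) :=
  (MeasurableEquiv.toLp 2 (Fin 2 → ℝ)).measurableEmbedding.comp
    (MeasurableEquiv.finTwoArrow (α := ℝ)).symm.measurableEmbedding

theorem continuous_toPlane : Continuous (fun z : ℝ × ℝ => (!₂[z.1, z.2] : Plane)) := by
  refine (PiLp.continuous_toLp 2 _).comp (continuous_pi fun i => ?_)
  fin_cases i
  · exact continuous_fst
  · exact continuous_snd

theorem integral_plane {f : Plane → ℝ} (hf : Integrable f) :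
    ∫ x, f x = ∫ s, ∫ t, f !₂[s, t] := by
  rw [← measurePreserving_toPlane.integral_comp measurableEmbedding_toPlane, Measure.volume_eq_prod,
    integral_prod]
  exact (measurePreserving_toPlane.integrable_comp_emb measurableEmbedding_toPlane).2 hf

theorem integral_plane_symm {f : Plane → ℝ} (hf : Integrable f) :
    ∫ x, f x = ∫ t, ∫ s, f !₂[s, t] := by
  rw [← measurePreserving_toPlane.integral_comp measurableEmbedding_toPlane, Measure.volume_eq_prod,
    integral_prod_symm]
  exact (measurePreserving_toPlane.integrable_comp_emb measurableEmbedding_toPlane).2 hf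

theorem continuous_refBary (a : Fin 3) : Continuous (refBary a) := by
  unfold refBary
  fin_cases a <;> simp <;> fun_prop

theorem isClosed_refTriangle : IsClosed refTriangle := by
  have h : refTriangle = ⋂ a, {ξ | 0 ≤ refBary a ξ} := by
    ext ξ; simp [mem_refTriangle_iff]
  rw [h]
  refine isClosed_iInter fun a => isClosed_le continuous_const ?_
  exact continuous_refBary a

theorem isCompact_refTriangle : IsCompact refTriangle := by
  refine Metric.isCompact_of_isClosed_isBounded isClosed_refTriangle ?_
  refine (Metric.isBounded_closedBall (x := (0 : Plane)) (r := 2)).subset fun ξ hξ => ?_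
  obtain ⟨⟨h0, h1⟩, ⟨h2, h3⟩, -⟩ := hξ
  rw [mem_closedBall_zero_iff, EuclideanSpace.norm_eq, Fin.sum_univ_two]
  refine Real.sqrt_le_iff.2 ⟨by norm_num, ?_⟩
  simp only [Real.norm_eq_abs, sq_abs]
  nlinarith

theorem mem_refTriangle_toPlane {s t : ℝ} :
    (!₂[s, t] : Plane) ∈ refTriangle ↔ t ∈ Icc (0 : ℝ) 1 ∧ s ∈ Icc 0 (1 - t) := by
  simp only [refTriangle, mem_ofPred_eq, mem_Icc]
  simp
  constructor
  · rintro ⟨⟨_, _⟩, ⟨_, _⟩, _⟩; refine ⟨⟨?_, ?_⟩, ?_, ?_⟩ <;> linarith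
  · rintro ⟨⟨_, _⟩, _, _⟩; refine ⟨⟨?_, ?_⟩, ⟨?_, ?_⟩, ?_⟩ <;> linarith

/-- The integral of a derivative along the segments `{t} × [0, 1 - t]`. -/
theorem integral_segments {P : Set (ℝ × ℝ)}
    (hP : ∀ t s, (t, s) ∈ P ↔ t ∈ Icc (0 : ℝ) 1 ∧ s ∈ Icc 0 (1 - t)) {F f : ℝ → ℝ → ℝ}
    (hF : ∀ t s, (t, s) ∈ P → HasDerivAt (F t) (f t s) s)
    (hf : ∀ t ∈ Icc (0 : ℝ) 1, ContinuousOn (f t) (Icc 0 (1 - t))) :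
    ∫ t, ∫ s, P.indicator (fun z => f z.1 z.2) (t, s) = ∫ t in (0 : ℝ)..1, (F t (1 - t) - F t 0) := by
  rw [intervalIntegral.integral_of_le zero_le_one, ← integral_Icc_eq_integral_Ioc,
    ← integral_indicator measurableSet_Icc]
  congr 1
  ext t
  by_cases ht : t ∈ Icc (0 : ℝ) 1
  · rw [indicator_of_mem ht]
    have h : ∀ s, P.indicator (fun z => f z.1 z.2) (t, s) = (Icc 0 (1 - t)).indicator (f t) s := by
      intro s
      by_cases hs : s ∈ Icc 0 (1 - t)
      · rw [indicator_of_mem hs, indicator_of_mem ((hP t s).2 ⟨ht, hs⟩)]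
      · rw [indicator_of_notMem hs, indicator_of_notMem fun h => hs ((hP t s).1 h).2]
    have h01 : 0 ≤ 1 - t := by linarith [ht.2]
    simp only [h]
    rw [integral_indicator measurableSet_Icc, integral_Icc_eq_integral_Ioc,
      ← intervalIntegral.integral_of_le h01]
    refine intervalIntegral.integral_eq_sub_of_hasDerivAt (fun s hs => ?_) ?_
    · rw [uIcc_of_le h01] at hs
      exact hF t s ((hP t s).2 ⟨ht, hs⟩)
    · refine ContinuousOn.intervalIntegrable ?_
      rw [uIcc_of_le h01]
      exact hf t ht
  · rw [indicator_of_notMem ht]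
    have h : ∀ s, P.indicator (fun z => f z.1 z.2) (t, s) = 0 := fun s =>
      indicator_of_notMem (fun h => ht ((hP t s).1 h).1) _
    simp [h]

theorem toPlane_eq (s t : ℝ) : (!₂[s, t] : Plane) =
    s • EuclideanSpace.single 0 1 + t • EuclideanSpace.single 1 1 := by
  apply plane_ext <;> simp

theorem hasDerivAt_toPlane_fst (s t : ℝ) :
    HasDerivAt (fun s => (!₂[s, t] : Plane)) (EuclideanSpace.single 0 1) s := by
  simp only [toPlane_eq]
  simpa using ((hasDerivAt_id s).smul_const (EuclideanSpace.single 0 1 : Plane)).add_const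
    (t • EuclideanSpace.single 1 1 : Plane)

theorem hasDerivAt_toPlane_snd (s t : ℝ) :
    HasDerivAt (fun t => (!₂[s, t] : Plane)) (EuclideanSpace.single 1 1) t := by
  simp only [toPlane_eq]
  simpa using ((hasDerivAt_id t).smul_const (EuclideanSpace.single 1 1 : Plane)).const_add
    (s • EuclideanSpace.single 0 1 : Plane)

theorem continuousOn_partialD {G : Plane → ℝ} {S : Set Plane}
    (hG : ∀ ξ ∈ S, ContDiffAt ℝ 1 G ξ) (i : Fin 2) : ContinuousOn (partialD i G) S := by
  intro ξ hξ
  exact (((hG ξ hξ).continuousAt_fderiv one_ne_zero).clm_apply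
    continuousAt_const).continuousWithinAt

theorem integral_partialD_zero {G : Plane → ℝ} (hG : ∀ ξ ∈ refTriangle, ContDiffAt ℝ 1 G ξ) :
    ∫ ξ in refTriangle, partialD 0 G ξ = ∫ t in (0 : ℝ)..1, (G !₂[1 - t, t] - G !₂[0, t]) := by
  have hc := continuousOn_partialD hG 0
  rw [← integral_indicator isClosed_refTriangle.measurableSet, integral_plane_symm
    ((integrable_indicator_iff isClosed_refTriangle.measurableSet).2
      (hc.integrableOn_compact isCompact_refTriangle))]
  refine integral_segments (P := {z | (!₂[z.2, z.1] : Plane) ∈ refTriangle})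
    (F := fun t s => G !₂[s, t]) (f := fun t s => partialD 0 G !₂[s, t])
    (fun t s => mem_refTriangle_toPlane) (fun t s h => ?_) fun t ht => ?_
  · exact ((hG _ h).differentiableAt one_ne_zero).hasFDerivAt.comp_hasDerivAt s
      (hasDerivAt_toPlane_fst s t)
  · exact hc.comp (f := fun s => (!₂[s, t] : Plane))
      (fun s _ => (hasDerivAt_toPlane_fst s t).continuousAt.continuousWithinAt)
      fun s hs => mem_refTriangle_toPlane.2 ⟨ht, hs⟩

theorem integral_partialD_one {G : Plane → ℝ} (hG : ∀ ξ ∈ refTriangle, ContDiffAt ℝ 1 G ξ) :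
    ∫ ξ in refTriangle, partialD 1 G ξ = ∫ t in (0 : ℝ)..1, (G !₂[t, 1 - t] - G !₂[t, 0]) := by
  have hc := continuousOn_partialD hG 1
  have hm : ∀ s t : ℝ, (!₂[s, t] : Plane) ∈ refTriangle ↔ s ∈ Icc (0 : ℝ) 1 ∧ t ∈ Icc 0 (1 - s) := by
    intro s t
    rw [mem_refTriangle_toPlane]
    simp only [mem_Icc]
    constructor <;> rintro ⟨⟨_, _⟩, _, _⟩ <;> refine ⟨⟨?_, ?_⟩, ?_, ?_⟩ <;> linarith
  rw [← integral_indicator isClosed_refTriangle.measurableSet, integral_plane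
    ((integrable_indicator_iff isClosed_refTriangle.measurableSet).2
      (hc.integrableOn_compact isCompact_refTriangle))]
  refine integral_segments (P := {z | (!₂[z.1, z.2] : Plane) ∈ refTriangle})
    (F := fun s t => G !₂[s, t]) (f := fun s t => partialD 1 G !₂[s, t])
    hm (fun s t h => ?_) fun s hs => ?_
  · exact ((hG _ h).differentiableAt one_ne_zero).hasFDerivAt.comp_hasDerivAt t
      (hasDerivAt_toPlane_snd s t)
  · exact hc.comp (f := fun t => (!₂[s, t] : Plane))
      (fun t _ => (hasDerivAt_toPlane_snd s t).continuousAt.continuousWithinAt)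
      fun t ht => (hm s t).2 ⟨hs, ht⟩

/-- The orientation of the edges in Green's formula. -/
def edgeSign : Fin 3 → ℤ := ![1, -1, 1]

theorem continuous_edgeParam (e : Fin 3) : Continuous (edgeParam e) := by
  unfold edgeParam; fun_prop

/-- Green's formula on the reference triangle. -/
theorem integral_rot_refTriangle {F₀ F₁ : Plane → ℝ}
    (h₀ : ∀ ξ ∈ refTriangle, ContDiffAt ℝ 1 F₀ ξ) (h₁ : ∀ ξ ∈ refTriangle, ContDiffAt ℝ 1 F₁ ξ) :
    ∫ ξ in refTriangle, (partialD 1 F₀ ξ - partialD 0 F₁ ξ) =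
      ∫ t in (0 : ℝ)..1, ∑ e, (edgeSign e : ℝ) *
        (F₀ (edgeParam e t) * refTangent e 0 + F₁ (edgeParam e t) * refTangent e 1) := by
  have hi : ∀ (F : Plane → ℝ), (∀ ξ ∈ refTriangle, ContDiffAt ℝ 1 F ξ) → ∀ e,
      IntervalIntegrable (fun t => F (edgeParam e t)) volume 0 1 := by
    intro F hF e
    refine ContinuousOn.intervalIntegrable fun t ht => ?_
    rw [uIcc_of_le zero_le_one] at ht
    exact ((hF _ (edgeParam_mem_refTriangle e ht)).continuousAt.comp
      (continuous_edgeParam e).continuousAt).continuousWithinAt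
  have hE0 : ∀ t : ℝ, edgeParam 0 t = !₂[0, t] := fun t => by
    apply plane_ext <;> simp [edgeParam, refTangent, refVertex, edgeFst, edgeSnd, e₂]
  have hE1 : ∀ t : ℝ, edgeParam 1 t = !₂[t, 0] := fun t => by
    apply plane_ext <;> simp [edgeParam, refTangent, refVertex, edgeFst, edgeSnd, e₁]
  have hE2 : ∀ t : ℝ, edgeParam 2 t = !₂[t, 1 - t] := fun t => by
    apply plane_ext <;> simp [edgeParam, refTangent, refVertex, edgeFst, edgeSnd, e₁, e₂]
    ring
  have hint : ∀ (F : Plane → ℝ), (∀ ξ ∈ refTriangle, ContDiffAt ℝ 1 F ξ) → ∀ i,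
      IntegrableOn (partialD i F) refTriangle := fun F hF i =>
    (continuousOn_partialD hF i).integrableOn_compact isCompact_refTriangle
  rw [integral_sub (hint F₀ h₀ 1) (hint F₁ h₁ 0), integral_partialD_one h₀,
    integral_partialD_zero h₁]
  have hr : ∫ t in (0 : ℝ)..1, F₁ !₂[1 - t, t] = ∫ t in (0 : ℝ)..1, F₁ !₂[t, 1 - t] := by
    have := intervalIntegral.integral_comp_sub_left (a := 0) (b := 1)
      (fun t => F₁ !₂[t, 1 - t]) (1 : ℝ)
    simpa using this
  have hi1 : IntervalIntegrable (fun t => F₁ !₂[1 - t, t]) volume 0 1 := by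
    have := (hi F₁ h₁ 2).comp_sub_left 1
    simp only [hE2] at this
    simpa using this.symm
  have a0 := hi F₀ h₀ 0
  have a1 := hi F₀ h₀ 1
  have a2 := hi F₀ h₀ 2
  have b0 := hi F₁ h₁ 0
  have b2 := hi F₁ h₁ 2
  simp only [hE0, hE1, hE2] at a0 a1 a2 b0 b2
  rw [intervalIntegral.integral_sub a2 a1, intervalIntegral.integral_sub hi1 b0, hr]
  have : ∀ t : ℝ, ∑ e, (edgeSign e : ℝ) *
        (F₀ (edgeParam e t) * refTangent e 0 + F₁ (edgeParam e t) * refTangent e 1) =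
      (F₀ !₂[t, 1 - t] - F₀ !₂[t, 0]) - (F₁ !₂[t, 1 - t] - F₁ !₂[0, t]) := by
    intro t
    rw [Fin.sum_univ_three, hE0, hE1, hE2]
    simp [edgeSign, refTangent, refVertex, edgeFst, edgeSnd, e₁, e₂]
    ring
  simp only [this]
  rw [intervalIntegral.integral_sub (a2.sub a1) (b2.sub b0), intervalIntegral.integral_sub a2 a1,
    intervalIntegral.integral_sub b2 b0]

theorem integral_partialD_strip {S : Set ℝ} (hS : MeasurableSet S) {c : ℝ}
    (hSc : ∀ f : ℝ → ℝ, ContDiff ℝ 1 f → HasCompactSupport f → ∫ s in S, deriv f s = c * f 0)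
    {G : Plane → ℝ} (hG : ContDiff ℝ 1 G) (hs : HasCompactSupport G) :
    ∫ y in {y : Plane | y 0 ∈ S}, partialD 0 G y = c * ∫ t, G !₂[0, t] := by
  have hm : MeasurableSet {y : Plane | y 0 ∈ S} :=
    (Continuous.measurable (f := fun y : Plane => y 0) (by fun_prop)) hS
  have hi : Integrable (partialD 0 G) := by
    refine Continuous.integrable_of_hasCompactSupport
      ((hG.continuous_fderiv one_ne_zero).clm_apply continuous_const)
      (hs.fderiv_apply ℝ _)
  rw [← integral_indicator hm, integral_plane_symm (hi.indicator hm), ← integral_const_mul]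
  congr 1
  ext t
  have hd : ∀ s, deriv (fun s => G !₂[s, t]) s = partialD 0 G !₂[s, t] := fun s =>
    ((hG.differentiable one_ne_zero _).hasFDerivAt.comp_hasDerivAt s
      (hasDerivAt_toPlane_fst s t)).deriv
  have hcd : ContDiff ℝ 1 (fun s : ℝ => (!₂[s, t] : Plane)) := by
    simp only [toPlane_eq]
    fun_prop
  have hcs : HasCompactSupport (fun s => G !₂[s, t]) := by
    refine HasCompactSupport.intro (hs.isCompact.image (f := fun y : Plane => y 0) (by fun_prop))
      fun s h => ?_
    by_contra h'
    exact h ⟨_, subset_tsupport _ h', by simp⟩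
  refine Eq.trans ?_ (hSc (fun s => G !₂[s, t]) (hG.comp hcd) hcs)
  rw [← integral_indicator hS]
  congr 1
  ext s
  by_cases h : s ∈ S
  · rw [indicator_of_mem (by simpa using h), indicator_of_mem h]
    exact (hd s).symm
  · rw [indicator_of_notMem (by simpa using h), indicator_of_notMem h]

theorem integral_partialD_left {G : Plane → ℝ} (hG : ContDiff ℝ 1 G) (hs : HasCompactSupport G) :
    ∫ y in {y : Plane | y 0 ∈ Iic 0}, partialD 0 G y = ∫ t, G !₂[0, t] := by
  rw [integral_partialD_strip (c := 1) measurableSet_Iic (fun f hf hc => ?_) hG hs, one_mul]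
  rw [HasCompactSupport.integral_Iic_deriv_eq hf hc, one_mul]

theorem integral_partialD_right {G : Plane → ℝ} (hG : ContDiff ℝ 1 G) (hs : HasCompactSupport G) :
    ∫ y in {y : Plane | y 0 ∈ Ioi 0}, partialD 0 G y = - ∫ t, G !₂[0, t] := by
  rw [integral_partialD_strip (c := -1) measurableSet_Ioi (fun f hf hc => ?_) hG hs, neg_one_mul]
  rw [HasCompactSupport.integral_Ioi_deriv_eq hf hc, neg_one_mul]

end TriNedelec

namespace TriNedelec
open MeasureTheory Set

open Classical in
/-- A piecewise smooth function in `H¹(A)` has no jump across a line. -/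
theorem MemH1.eq_of_piecewise {A : Set Plane} (hA : IsOpen A) {L R : Plane → ℝ}
    (hL : ContDiff ℝ ∞ L) (hR : ContDiff ℝ ∞ R)
    {S : Set Plane} (hS : S = {y : Plane | y 0 ∈ Iic 0})
    (hu : MemH1 A (S.piecewise L R)) {t₀ : ℝ} (ht : !₂[0, t₀] ∈ A) :
    L !₂[0, t₀] = R !₂[0, t₀] := by
  have hSc : Sᶜ = {y : Plane | y 0 ∈ Ioi 0} := by ext; simp [hS]
  have hSm : MeasurableSet S := hS ▸
    (Continuous.measurable (f := fun y : Plane => y 0) (by fun_prop)) measurableSet_Iic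
  obtain ⟨g, hg, hgφ⟩ : ∃ g : Plane → ℝ, MemLp g 2 (volume.restrict A) ∧ ∀ φ, IsTestFn A φ →
      ∫ y in A, S.piecewise L R y * partialD 0 φ y = - ∫ y in A, g y * φ y := by
    obtain ⟨g, hg⟩ := hu.2
    exact ⟨g 0, hg 0⟩
  have hcD : ∀ {F : Plane → ℝ}, ContDiff ℝ ∞ F → Continuous (partialD 0 F) := fun hF =>
    (hF.continuous_fderiv (by simp)).clm_apply continuous_const
  have hmulD : ∀ {F φ : Plane → ℝ}, ContDiff ℝ ∞ F → ContDiff ℝ ∞ φ → ∀ y,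
      partialD 0 (fun y => F y * φ y) y = F y * partialD 0 φ y + partialD 0 F y * φ y := by
    intro F φ hF hφ y
    have := (((hF.differentiable (by simp) y).hasFDerivAt).mul
      ((hφ.differentiable (by simp) y).hasFDerivAt)).fderiv
    simp only [partialD]
    change (fderiv ℝ (F * φ) y) _ = _
    rw [this]
    simp [mul_comm]
  set d : Plane → ℝ := S.piecewise (partialD 0 L) (partialD 0 R) with hd
  have hdloc : LocallyIntegrable d := by
    have h : d = S.indicator (partialD 0 L) + Sᶜ.indicator (partialD 0 R) := by
      rw [hd, ← indicator_add_compl_eq_piecewise]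
    rw [h]
    exact ((hcD hL).locallyIntegrable.indicator hSm).add
      ((hcD hR).locallyIntegrable.indicator hSm.compl)
  have hgloc : LocallyIntegrableOn g A :=
    locallyIntegrableOn_of_locallyIntegrable_restrict (hg.locallyIntegrable one_le_two)
  have key : ∀ φ, IsTestFn A φ →
      ∫ y, φ y • (d y - g y) = ∫ t, (L !₂[0, t] - R !₂[0, t]) * φ !₂[0, t] := by
    rintro φ ⟨hφ, hφc, hφA⟩
    have hφ1 : ContDiff ℝ 1 φ := hφ.of_le (by simp)
    have hi : ∀ {F : Plane → ℝ}, Continuous F → Integrable (fun y => F y * φ y) := fun hF =>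
      (hF.mul hφ.continuous).integrable_of_hasCompactSupport hφc.mul_left
    have hi' : ∀ {F : Plane → ℝ}, Continuous F → Integrable (fun y => F y * partialD 0 φ y) :=
      fun hF => (hF.mul (hcD hφ)).integrable_of_hasCompactSupport
        (HasCompactSupport.mul_left (hφc.fderiv_apply ℝ _))
    have hdφ : Integrable (fun y => d y * φ y) := by
      have h : (fun y => d y * φ y) = S.piecewise (fun y => partialD 0 L y * φ y)
          (fun y => partialD 0 R y * φ y) := by
        ext y; by_cases hy : y ∈ S <;> simp [hd, hy]
      rw [h]
      exact Integrable.piecewise hSm (hi (hcD hL)).integrableOn (hi (hcD hR)).integrableOn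
    have huφ : Integrable (fun y => S.piecewise L R y * partialD 0 φ y) := by
      have h : (fun y => S.piecewise L R y * partialD 0 φ y) =
          S.piecewise (fun y => L y * partialD 0 φ y) (fun y => R y * partialD 0 φ y) := by
        ext y; by_cases hy : y ∈ S <;> simp [hy]
      rw [h]
      exact Integrable.piecewise hSm (hi' hL.continuous).integrableOn
        (hi' hR.continuous).integrableOn
    have hgφi : Integrable (fun y => g y * φ y) := by
      have h : IntegrableOn (fun y => g y * φ y) A :=
        hg.integrable_mul (q := 2) (hφ.continuous.memLp_of_hasCompactSupport hφc)
      refine (integrableOn_iff_integrable_of_support_subset fun y hy => ?_).1 h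
      exact hφA (subset_tsupport _ (right_ne_zero_of_mul hy))
    have hout : ∀ y ∉ A, φ y = 0 := fun y hy => image_eq_zero_of_notMem_tsupport fun h => hy (hφA h)
    have hout' : ∀ y ∉ A, partialD 0 φ y = 0 := fun y hy => by
      have : fderiv ℝ φ y = 0 :=
        image_eq_zero_of_notMem_tsupport fun h => hy (hφA (tsupport_fderiv_subset ℝ h))
      simp [partialD, this]
    have hH := hgφ φ ⟨hφ, hφc, hφA⟩
    rw [setIntegral_eq_integral_of_forall_compl_eq_zero fun y hy => by rw [hout' y hy, mul_zero],
      setIntegral_eq_integral_of_forall_compl_eq_zero fun y hy => by rw [hout y hy, mul_zero]] at hH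
    have hsum : ∫ y, (S.piecewise L R y * partialD 0 φ y + d y * φ y) =
        ∫ t, (L !₂[0, t] - R !₂[0, t]) * φ !₂[0, t] := by
      have hi2 : Integrable fun y => S.piecewise L R y * partialD 0 φ y + d y * φ y := huφ.add hdφ
      rw [← integral_add_compl hSm hi2]
      have h1 : ∫ y in S, (S.piecewise L R y * partialD 0 φ y + d y * φ y) =
          ∫ y in S, partialD 0 (fun y => L y * φ y) y :=
        setIntegral_congr_fun hSm fun y hy => by simp [hd, hy, hmulD hL hφ]
      have h2 : ∫ y in Sᶜ, (S.piecewise L R y * partialD 0 φ y + d y * φ y) =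
          ∫ y in Sᶜ, partialD 0 (fun y => R y * φ y) y :=
        setIntegral_congr_fun hSm.compl fun y hy => by
          simp [hd, notMem_of_mem_compl hy, hmulD hR hφ]
      have hline : ∀ {F : Plane → ℝ}, ContDiff ℝ ∞ F →
          Integrable fun t : ℝ => F !₂[0, t] * φ !₂[0, t] := by
        intro F hF
        have hc : Continuous fun t : ℝ => (!₂[0, t] : Plane) :=
          continuous_toPlane.comp (Continuous.prodMk_right 0)
        refine Continuous.integrable_of_hasCompactSupport
          ((hF.continuous.comp hc).mul (hφ.continuous.comp hc)) ?_
        refine HasCompactSupport.intro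
          (hφc.isCompact.image (f := fun y : Plane => y 1) (by fun_prop)) fun s h => ?_
        by_contra h'
        exact h ⟨_, subset_tsupport _ (right_ne_zero_of_mul h'), by simp⟩
      rw [h1, h2, hSc, hS, integral_partialD_left ((hL.of_le (by simp)).mul hφ1) hφc.mul_left,
        integral_partialD_right ((hR.of_le (by simp)).mul hφ1) hφc.mul_left, ← sub_eq_add_neg,
        ← integral_sub (hline hL) (hline hR)]
      simp only [sub_mul]
    rw [← hsum, integral_add huφ hdφ, hH]
    have : ∀ y, φ y • (d y - g y) = d y * φ y - g y * φ y := fun y => by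
      rw [smul_eq_mul]; ring
    simp only [this]
    rw [integral_sub hdφ hgφi]
    ring
  have hline0 : volume {y : Plane | y 0 = 0} = 0 := by
    have hm : MeasurableSet {y : Plane | y 0 = 0} :=
      (isClosed_eq (by fun_prop) continuous_const).measurableSet
    rw [← measurePreserving_toPlane.measure_preimage hm.nullMeasurableSet]
    have : (fun z : ℝ × ℝ => (!₂[z.1, z.2] : Plane)) ⁻¹' {y : Plane | y 0 = 0} =
        ({0} : Set ℝ) ×ˢ univ := by ext z; simp
    rw [this, Measure.volume_eq_prod, Measure.prod_prod]
    simp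
  have hzero : ∀ᵐ y : Plane, y ∈ A → d y - g y = 0 := by
    have hU : IsOpen (A ∩ {y : Plane | y 0 ≠ 0}) :=
      hA.inter (isOpen_ne_fun (by fun_prop) continuous_const)
    have hloc : LocallyIntegrableOn (fun y => d y - g y) (A ∩ {y : Plane | y 0 ≠ 0}) :=
      (hdloc.locallyIntegrableOn _).sub (hgloc.mono_set inter_subset_left)
    have := hU.ae_eq_zero_of_integral_contDiff_smul_eq_zero hloc fun φ hφ hφc hφU => by
      rw [key φ ⟨hφ, hφc, hφU.trans inter_subset_left⟩]
      refine integral_eq_zero_of_ae (Filter.Eventually.of_forall fun t => ?_)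
      have : φ !₂[0, t] = 0 :=
        image_eq_zero_of_notMem_tsupport fun h => (hφU h).2 (by simp)
      simp [this]
    filter_upwards [this, compl_mem_ae_iff.2 hline0] with y hy hy0 hyA
    exact hy ⟨hyA, hy0⟩
  by_contra hne
  obtain ⟨b, hbA, hbc, hb, hbr, hb1⟩ := exists_contDiff_tsupport_subset (n := ⊤) (hA.mem_nhds ht)
  have hφ : IsTestFn A (fun y => b y * (L y - R y)) :=
    ⟨hb.mul (hL.sub hR), hbc.mul_right, (tsupport_mul_subset_left).trans hbA⟩
  have h := key _ hφ
  rw [integral_eq_zero_of_ae] at h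
  · have hc : Continuous fun t : ℝ => (!₂[0, t] : Plane) :=
      continuous_toPlane.comp (Continuous.prodMk_right 0)
    have hpos : 0 < ∫ t : ℝ, (L !₂[0, t] - R !₂[0, t]) *
        (b !₂[0, t] * (L !₂[0, t] - R !₂[0, t])) := by
      refine Continuous.integral_pos_of_hasCompactSupport_nonneg_nonzero (x := t₀) ?_ ?_ ?_ ?_
      · have h1 := hL.continuous.comp hc
        have h2 := hR.continuous.comp hc
        have h3 := hb.continuous.comp hc
        exact (h1.sub h2).mul (h3.mul (h1.sub h2))
      · refine HasCompactSupport.intro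
          (hbc.isCompact.image (f := fun y : Plane => y 1) (by fun_prop)) fun s h => ?_
        by_contra h'
        exact h ⟨_, subset_tsupport _ (left_ne_zero_of_mul (right_ne_zero_of_mul h')), by simp⟩
      · intro t
        have : 0 ≤ b !₂[0, t] := (hbr ⟨_, rfl⟩).1
        have := mul_nonneg this (sq_nonneg (L !₂[0, t] - R !₂[0, t]))
        simp only [Pi.zero_apply]
        linarith
      · rw [hb1]
        have := sub_ne_zero.2 hne
        positivity
    exact hpos.ne h
  · filter_upwards [hzero] with y hy
    by_cases hyA : y ∈ A
    · simp [hy hyA]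
    · have : b y = 0 := image_eq_zero_of_notMem_tsupport fun h => hyA (hbA h)
      simp [this]

end TriNedelec

namespace TriNedelec
open MeasureTheory Set

theorem refBary_lineMap (a b : Fin 3) (ξ : Plane) (r : ℝ) :
    refBary a (ξ + r • (ξ - refVertex b)) =
      refBary a ξ + r * (refBary a ξ - if a = b then 1 else 0) := by
  fin_cases a <;> fin_cases b <;> simp [refBary, refVertex, e₁, e₂] <;> ring

theorem mem_interior_refTriangle_iff (ξ : Plane) :
    ξ ∈ interior refTriangle ↔ ∀ a, 0 < refBary a ξ := by
  constructor
  · intro h a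
    refine lt_of_le_of_ne ((mem_refTriangle_iff ξ).1 (interior_subset h) a) fun h0 => ?_
    have hc : Filter.Tendsto (fun r : ℝ => ξ + r • (ξ - refVertex a)) (nhds 0) (nhds ξ) := by
      have : Continuous (fun r : ℝ => ξ + r • (ξ - refVertex a)) := by fun_prop
      simpa using this.tendsto 0
    obtain ⟨r, hr, hr0⟩ := (((hc.eventually (isOpen_interior.mem_nhds h)).filter_mono
      nhdsWithin_le_nhds).and (self_mem_nhdsWithin (s := Ioi (0 : ℝ)))).exists
    have := (mem_refTriangle_iff _).1 (interior_subset hr) a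
    rw [refBary_lineMap, ← h0] at this
    simp only [if_true] at this
    have hr0 : 0 < r := hr0
    linarith
  · intro h
    have ho : IsOpen (⋂ a, {ξ | 0 < refBary a ξ}) :=
      isOpen_iInter_of_finite fun a => isOpen_lt continuous_const (continuous_refBary a)
    refine interior_maximal (fun ζ hζ => ?_) ho (mem_iInter.2 h)
    exact (mem_refTriangle_iff ζ).2 fun a => (mem_iInter.1 hζ a).le

theorem contDiff_polyEval (q : MvPolynomial (Fin 2) ℝ) {n : ℕ∞ω} : ContDiff ℝ n (polyEval q) := by
  unfold polyEval
  induction q using MvPolynomial.induction_on with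
  | C a => simpa using contDiff_const
  | add q r hq hr => simpa using hq.add hr
  | mul_X q i hq =>
    have : ContDiff ℝ n fun ξ : Plane => ξ i := by fun_prop
    simpa using hq.mul this

theorem contDiff_scalar_onElement {p : ℕ} {B : PolytopalBasis p} {A : Set Plane}
    (M : Triangulation A) (c : ScalarCoeffs p M.m) (T : Fin M.m) {n : ℕ∞ω} :
    ContDiff ℝ n (c.onElement B M T) := by
  unfold ScalarCoeffs.onElement
  refine ((ContDiff.sum fun i _ => contDiff_const.mul (contDiff_polyEval _)).add
    (ContDiff.sum fun i _ => ContDiff.sum fun k _ => contDiff_const.mul (contDiff_polyEval _))).add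
    (ContDiff.sum fun k _ => contDiff_const.mul (contDiff_polyEval _))

theorem scalar_onElement_edge {p : ℕ} {B : PolytopalBasis p} {A : Set Plane}
    (M : Triangulation A) (c : ScalarCoeffs p M.m) (T : Fin M.m) (e : Fin 3) {ξ : Plane}
    (hξ : ξ ∈ refEdge e) :
    c.onElement B M T ξ = c.vertex (M.vtx T (edgeFst e)) * polyEval (B.vertexFn (edgeFst e)) ξ
      + c.vertex (M.vtx T (edgeSnd e)) * polyEval (B.vertexFn (edgeSnd e)) ξ
      + ∑ k, c.edge (M.vtx T (edgeFst e)) (M.vtx T (edgeSnd e)) k *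
          polyEval (B.edgeFn e k) ξ := by
  have hopp : polyEval (B.vertexFn (edgeOpp e)) ξ = 0 :=
    B.vertexFn_edge _ e (by fin_cases e <;> simp [edgeFst, edgeOpp])
      (by fin_cases e <;> simp [edgeSnd, edgeOpp]) ξ hξ
  rw [ScalarCoeffs.onElement, sum_vertex e, hopp, mul_zero, add_zero,
    Finset.sum_eq_single_of_mem e (Finset.mem_univ e) fun e' _ he =>
      Finset.sum_eq_zero fun k _ => by rw [B.edgeFn_edge e' k e he.symm ξ hξ, mul_zero],
    Finset.sum_eq_zero (f := fun k => c.cell T k * polyEval (B.cellFn k) ξ)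
      fun k _ => by rw [B.cellFn_edge k e ξ hξ, mul_zero], add_zero]

/-- The affine map onto the triangle with vertices `0`, `e₂` and `σ e₁` that takes the edge `e`
to the segment from `0` to `e₂`. -/
noncomputable def wedgeMap (σ : ℝ) (e : Fin 3) (ξ : Plane) : Plane :=
  !₂[σ * refBary (edgeOpp e) ξ, refBary (edgeSnd e) ξ]

/-- The inverse of `wedgeMap σ e` for `σ = ±1`. -/
noncomputable def wedgeInv (σ : ℝ) (e : Fin 3) (y : Plane) : Plane :=
  (1 - y 1 - σ * y 0) • refVertex (edgeFst e) + y 1 • refVertex (edgeSnd e) +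
    (σ * y 0) • refVertex (edgeOpp e)

theorem refBary_fst_wedgeInv (σ : ℝ) (e : Fin 3) (y : Plane) :
    refBary (edgeFst e) (wedgeInv σ e y) = 1 - y 1 - σ * y 0 := by
  fin_cases e <;> simp [refBary, wedgeInv, edgeFst, edgeSnd, edgeOpp, refVertex, e₁, e₂]
  ring

theorem refBary_snd_wedgeInv (σ : ℝ) (e : Fin 3) (y : Plane) :
    refBary (edgeSnd e) (wedgeInv σ e y) = y 1 := by
  fin_cases e <;> simp [refBary, wedgeInv, edgeFst, edgeSnd, edgeOpp, refVertex, e₁, e₂]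

theorem refBary_opp_wedgeInv (σ : ℝ) (e : Fin 3) (y : Plane) :
    refBary (edgeOpp e) (wedgeInv σ e y) = σ * y 0 := by
  fin_cases e <;> simp [refBary, wedgeInv, edgeFst, edgeSnd, edgeOpp, refVertex, e₁, e₂]

theorem wedgeInv_wedgeMap {σ : ℝ} (hσ : σ * σ = 1) (e : Fin 3) (ξ : Plane) :
    wedgeInv σ e (wedgeMap σ e ξ) = ξ := by
  have hs := sum_vertex e fun a => refBary a ξ
  rw [Fin.sum_univ_three, refBary_sum] at hs
  have h : σ * (σ * refBary (edgeOpp e) ξ) = refBary (edgeOpp e) ξ := by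
    rw [← mul_assoc, hσ, one_mul]
  refine plane_ext_refBary ((forall_vertex_iff e).2 ⟨?_, ?_, ?_⟩)
  · rw [refBary_fst_wedgeInv]; simp [wedgeMap, h]; linarith
  · rw [refBary_snd_wedgeInv]; simp [wedgeMap]
  · rw [refBary_opp_wedgeInv]; simp [wedgeMap, h]

theorem wedgeMap_wedgeInv {σ : ℝ} (hσ : σ * σ = 1) (e : Fin 3) (y : Plane) :
    wedgeMap σ e (wedgeInv σ e y) = y := by
  apply plane_ext
  · simp [wedgeMap, refBary_opp_wedgeInv, ← mul_assoc, hσ]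
  · simp [wedgeMap, refBary_snd_wedgeInv]

theorem wedgeInv_edge (σ : ℝ) (e : Fin 3) (t : ℝ) : wedgeInv σ e !₂[0, t] = edgeParam e t := by
  refine plane_ext_refBary ((forall_vertex_iff e).2 ⟨?_, ?_, ?_⟩)
  · rw [refBary_fst_wedgeInv, refBary_fst_edgeParam]; simp
  · rw [refBary_snd_wedgeInv, refBary_snd_edgeParam]; simp
  · rw [refBary_opp_wedgeInv, refBary_opp_edgeParam]; simp

theorem contDiff_refBary (a : Fin 3) {n : ℕ∞ω} : ContDiff ℝ n (refBary a) := by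
  unfold refBary
  fin_cases a <;> simp <;> fun_prop

theorem contDiff_wedgeMap (σ : ℝ) (e : Fin 3) {n : ℕ∞ω} : ContDiff ℝ n (wedgeMap σ e) := by
  unfold wedgeMap
  simp only [toPlane_eq]
  exact ((contDiff_const.mul (contDiff_refBary _)).smul contDiff_const).add
    ((contDiff_refBary _).smul contDiff_const)

theorem contDiff_wedgeInv (σ : ℝ) (e : Fin 3) {n : ℕ∞ω} : ContDiff ℝ n (wedgeInv σ e) := by
  unfold wedgeInv
  fun_prop

theorem isElementMap_wedgeMap {σ : ℝ} (hσ : σ * σ = 1) (e : Fin 3) :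
    IsElementMap (wedgeMap σ e) where
  contDiffAt ξ _ := (contDiff_wedgeMap σ e).contDiffAt
  injOn := (Function.LeftInverse.injective (wedgeInv_wedgeMap hσ e)).injOn
  det_ne_zero ξ _ := by
    have h : fderiv ℝ (wedgeInv σ e ∘ wedgeMap σ e) ξ =
        (fderiv ℝ (wedgeInv σ e) (wedgeMap σ e ξ)).comp (fderiv ℝ (wedgeMap σ e) ξ) :=
      fderiv_comp ξ ((contDiff_wedgeInv σ e (n := 1)).differentiable one_ne_zero _)
        ((contDiff_wedgeMap σ e (n := 1)).differentiable one_ne_zero _)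
    have hid : wedgeInv σ e ∘ wedgeMap σ e = id := funext (wedgeInv_wedgeMap hσ e)
    rw [hid, fderiv_id] at h
    have hd : LinearMap.det (LinearMap.id : Plane →ₗ[ℝ] Plane) =
        LinearMap.det ((fderiv ℝ (wedgeInv σ e) (wedgeMap σ e ξ) : Plane →ₗ[ℝ] Plane) ∘ₗ
          (fderiv ℝ (wedgeMap σ e) ξ : Plane →ₗ[ℝ] Plane)) := congrArg ContinuousLinearMap.det h
    intro h0
    rw [LinearMap.det_comp, LinearMap.det_id] at hd
    rw [ContinuousLinearMap.det] at h0
    rw [h0, mul_zero] at hd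
    exact one_ne_zero hd

/-- Increasing vertex numbers of a triangle whose edge `e` has the vertices `10` and `20`. -/
def wedgeVtx (d : ℕ) (e : Fin 3) : Fin 3 → ℕ :=
  ![![10, 20, 30 + d], ![10, 15 + d, 20], ![5 + d, 10, 20]] e

theorem wedgeVtx_fst (d : ℕ) (e : Fin 3) : wedgeVtx d e (edgeFst e) = 10 := by
  fin_cases e <;> simp [wedgeVtx, edgeFst]

theorem wedgeVtx_snd (d : ℕ) (e : Fin 3) : wedgeVtx d e (edgeSnd e) = 20 := by
  fin_cases e <;> simp [wedgeVtx, edgeSnd]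

theorem wedgeVtx_opp (d : ℕ) (e : Fin 3) :
    wedgeVtx d e (edgeOpp e) = ![30, 15, 5] e + d := by
  fin_cases e <;> simp [wedgeVtx, edgeOpp]

theorem strictMono_wedgeVtx {d : ℕ} (hd : d ≤ 1) (e : Fin 3) : StrictMono (wedgeVtx d e) := by
  rw [Fin.strictMono_iff_lt_succ]
  intro i
  fin_cases e <;> fin_cases i <;> simp [wedgeVtx] <;> omega

theorem globalBary_eq (s : Fin 3 → ℕ) (e : Fin 3) (ξ : Plane) (v : ℕ) : globalBary s ξ v =
    (if s (edgeFst e) = v then refBary (edgeFst e) ξ else 0) +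
    (if s (edgeSnd e) = v then refBary (edgeSnd e) ξ else 0) +
    (if s (edgeOpp e) = v then refBary (edgeOpp e) ξ else 0) :=
  sum_vertex e _

theorem globalBary_apply {s : Fin 3 → ℕ} (hs : Function.Injective s) (ξ : Plane) (a : Fin 3) :
    globalBary s ξ (s a) = refBary a ξ := by
  simp [globalBary, hs.eq_iff]

theorem globalBary_inj {s : Fin 3 → ℕ} (hs : Function.Injective s) {ξ ζ : Plane} :
    globalBary s ξ = globalBary s ζ ↔ ξ = ζ := by
  refine ⟨fun h => plane_ext_refBary fun a => ?_, fun h => h ▸ rfl⟩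
  rw [← globalBary_apply hs ξ a, h, globalBary_apply hs]

theorem wedge_conforming (e e' : Fin 3) {ξ ξ' : Plane} (hξ : ξ ∈ refTriangle)
    (hξ' : ξ' ∈ refTriangle) : wedgeMap (-1) e ξ = wedgeMap 1 e' ξ' ↔
      globalBary (wedgeVtx 0 e) ξ = globalBary (wedgeVtx 1 e') ξ' := by
  have hs := sum_vertex e fun a => refBary a ξ
  rw [Fin.sum_univ_three, refBary_sum] at hs
  have hs' := sum_vertex e' fun a => refBary a ξ'
  rw [Fin.sum_univ_three, refBary_sum] at hs'
  have h0 := (mem_refTriangle_iff ξ).1 hξ (edgeOpp e)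
  have h0' := (mem_refTriangle_iff ξ').1 hξ' (edgeOpp e')
  have hz : ((![30, 15, 5] e + 0 : ℕ) ≠ ![30, 15, 5] e' + 1 ∧ (![30, 15, 5] e + 0 : ℕ) ≠ 10 ∧
      (![30, 15, 5] e + 0 : ℕ) ≠ 20) ∧
      (![30, 15, 5] e' + 1 : ℕ) ≠ 10 ∧ (![30, 15, 5] e' + 1 : ℕ) ≠ 20 := by
    fin_cases e <;> fin_cases e' <;> simp
  generalize hze : (![30, 15, 5] e + 0 : ℕ) = z at hz
  generalize hze' : (![30, 15, 5] e' + 1 : ℕ) = z' at hz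
  obtain ⟨⟨hzz, hz1, hz2⟩, hz1', hz2'⟩ := hz
  constructor
  · intro h
    have ho := congrArg (fun y : Plane => y 0) h
    have ht := congrArg (fun y : Plane => y 1) h
    simp [wedgeMap] at ho ht
    have ho1 : refBary (edgeOpp e) ξ = 0 := by linarith
    have ho2 : refBary (edgeOpp e') ξ' = 0 := by linarith
    have hf : refBary (edgeFst e) ξ = refBary (edgeFst e') ξ' := by linarith
    funext v
    rw [globalBary_eq _ e, globalBary_eq _ e', wedgeVtx_fst, wedgeVtx_snd, wedgeVtx_fst,
      wedgeVtx_snd, ho1, ho2, ht, hf]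
    simp
  · intro h
    have hv : ∀ v,
        (if 10 = v then refBary (edgeFst e) ξ else 0) + (if 20 = v then refBary (edgeSnd e) ξ else 0)
          + (if z = v then refBary (edgeOpp e) ξ else 0) =
        (if 10 = v then refBary (edgeFst e') ξ' else 0)
          + (if 20 = v then refBary (edgeSnd e') ξ' else 0)
          + (if z' = v then refBary (edgeOpp e') ξ' else 0) := by
      intro v
      have := congrFun h v
      rwa [globalBary_eq _ e, globalBary_eq _ e', wedgeVtx_fst, wedgeVtx_snd, wedgeVtx_opp,
        wedgeVtx_fst, wedgeVtx_snd, wedgeVtx_opp, hze, hze'] at this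
    have a1 := hv 20
    have a2 := hv z
    have a3 := hv z'
    simp [hzz, hzz.symm, hz2, hz2', hz1.symm, hz2.symm, hz1'.symm, hz2'.symm] at a1 a2 a3
    apply plane_ext
    · simp [wedgeMap, a2, ← a3]
    · simp [wedgeMap, a1]

/-- The closed triangle with vertices `-e₁`, `e₁` and `e₂`. -/
def bigTriangle : Set Plane := {y | 0 ≤ y 1 ∧ y 0 + y 1 ≤ 1 ∧ -y 0 + y 1 ≤ 1}

theorem convex_bigTriangle : Convex ℝ bigTriangle := by
  rintro x ⟨hx1, hx2, hx3⟩ y ⟨hy1, hy2, hy3⟩ a b ha hb hab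
  simp only [bigTriangle, mem_ofPred_eq, PiLp.add_apply, PiLp.smul_apply, smul_eq_mul]
  refine ⟨by positivity, ?_, ?_⟩ <;> nlinarith

theorem isClosed_bigTriangle : IsClosed bigTriangle := by
  have h0 : IsClosed {y : Plane | 0 ≤ y 1} := isClosed_le continuous_const (by fun_prop)
  have h1 : IsClosed {y : Plane | y 0 + y 1 ≤ 1} := isClosed_le (by fun_prop) continuous_const
  have h2 : IsClosed {y : Plane | -y 0 + y 1 ≤ 1} := isClosed_le (by fun_prop) continuous_const
  exact h0.inter (h1.inter h2)

theorem mem_interior_bigTriangle {t : ℝ} (ht : t ∈ Ioo (0 : ℝ) 1) :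
    (!₂[0, t] : Plane) ∈ interior bigTriangle := by
  have h0 : IsOpen {y : Plane | 0 < y 1} := isOpen_lt continuous_const (by fun_prop)
  have h1 : IsOpen {y : Plane | y 0 + y 1 < 1} := isOpen_lt (by fun_prop) continuous_const
  have h2 : IsOpen {y : Plane | -y 0 + y 1 < 1} := isOpen_lt (by fun_prop) continuous_const
  have hsub : {y : Plane | 0 < y 1} ∩ ({y : Plane | y 0 + y 1 < 1} ∩
      {y : Plane | -y 0 + y 1 < 1}) ⊆ bigTriangle := by
    rintro y ⟨h0, h1, h2⟩
    exact ⟨le_of_lt h0, le_of_lt h1, le_of_lt h2⟩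
  refine interior_maximal hsub (h0.inter (h1.inter h2)) ?_
  simpa using ht

theorem mem_image_wedgeMap {σ : ℝ} (hσ : σ * σ = 1) (e : Fin 3) (y : Plane) :
    y ∈ wedgeMap σ e '' refTriangle ↔ 0 ≤ y 1 ∧ 0 ≤ σ * y 0 ∧ σ * y 0 + y 1 ≤ 1 := by
  have h : y ∈ wedgeMap σ e '' refTriangle ↔ wedgeInv σ e y ∈ refTriangle := by
    constructor
    · rintro ⟨ξ, hξ, rfl⟩
      rwa [wedgeInv_wedgeMap hσ]
    · exact fun h => ⟨_, h, wedgeMap_wedgeInv hσ e y⟩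
  rw [h, mem_refTriangle_iff, forall_vertex_iff e, refBary_fst_wedgeInv, refBary_snd_wedgeInv,
    refBary_opp_wedgeInv]
  constructor
  · rintro ⟨_, _, _⟩; refine ⟨?_, ?_, ?_⟩ <;> linarith
  · rintro ⟨_, _, _⟩; refine ⟨?_, ?_, ?_⟩ <;> linarith

/-- Two triangles glued along the edge `e` of the first and `e'` of the second. -/
noncomputable def wedgeTriangulation (e e' : Fin 3) : Triangulation (interior bigTriangle) where
  isOpen := isOpen_interior
  m := 2
  vtx := ![wedgeVtx 0 e, wedgeVtx 1 e']
  map := ![wedgeMap (-1) e, wedgeMap 1 e']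
  isElementMap T := by
    fin_cases T
    · exact isElementMap_wedgeMap (by norm_num) e
    · exact isElementMap_wedgeMap (by norm_num) e'
  vtx_strictMono T := by
    fin_cases T
    · exact strictMono_wedgeVtx zero_le_one e
    · exact strictMono_wedgeVtx le_rfl e'
  vtx_injective := by
    have h : wedgeVtx 0 e ≠ wedgeVtx 1 e' := by
      intro h
      have h0 := congrFun h 0
      have h1 := congrFun h 1
      have h2 := congrFun h 2
      fin_cases e <;> fin_cases e' <;> simp [wedgeVtx] at h0 h1 h2
    intro T T' hT
    fin_cases T <;> fin_cases T'
    · rfl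
    · exact absurd hT h
    · exact absurd hT.symm h
    · rfl
  conforming T T' ξ hξ ξ' hξ' := by
    fin_cases T <;> fin_cases T'
    · exact ((Function.LeftInverse.injective (wedgeInv_wedgeMap (by norm_num) e)).eq_iff).trans
        (globalBary_inj (strictMono_wedgeVtx zero_le_one e).injective).symm
    · exact wedge_conforming e e' hξ hξ'
    · exact eq_comm.trans ((wedge_conforming e e' hξ' hξ).trans eq_comm)
    · exact ((Function.LeftInverse.injective (wedgeInv_wedgeMap (by norm_num) e')).eq_iff).trans
        (globalBary_inj (strictMono_wedgeVtx le_rfl e').injective).symm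
  covers := by
    rw [convex_bigTriangle.closure_interior_eq_closure_of_nonempty_interior
      ⟨_, mem_interior_bigTriangle (t := 1 / 2) (by norm_num)⟩, isClosed_bigTriangle.closure_eq]
    ext y
    have h1 := mem_image_wedgeMap (σ := -1) (by norm_num) e y
    have h2 := mem_image_wedgeMap (σ := 1) (by norm_num) e' y
    simp only [mem_iUnion, Fin.exists_fin_two]
    change y ∈ wedgeMap (-1) e '' refTriangle ∨ y ∈ wedgeMap 1 e' '' refTriangle ↔ _
    rw [h1, h2]
    simp only [bigTriangle, mem_ofPred_eq]
    constructor
    · rintro (⟨_, _, _⟩ | ⟨_, _, _⟩) <;> refine ⟨?_, ?_, ?_⟩ <;> linarith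
    · rintro ⟨_, _, _⟩
      rcases le_total (y 0) 0 with h | h
      · left; refine ⟨?_, ?_, ?_⟩ <;> linarith
      · right; refine ⟨?_, ?_, ?_⟩ <;> linarith

variable {p : ℕ} {B : PolytopalBasis p}

open Classical in
theorem IsH1Conforming.onElement_eq (hB : IsH1Conforming B) (e e' : Fin 3)
    (c : ScalarCoeffs p 2) {t : ℝ} (ht : t ∈ Ioo (0 : ℝ) 1) :
    c.onElement B (wedgeTriangulation e e') (0 : Fin 2) (edgeParam e t) =
      c.onElement B (wedgeTriangulation e e') (1 : Fin 2) (edgeParam e' t) := by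
  set L : Plane → ℝ := fun y =>
    c.onElement B (wedgeTriangulation e e') (0 : Fin 2) (wedgeInv (-1) e y) with hL
  set R : Plane → ℝ := fun y =>
    c.onElement B (wedgeTriangulation e e') (1 : Fin 2) (wedgeInv 1 e' y) with hR
  have hmem : MemH1 (interior bigTriangle) ({y : Plane | y 0 ∈ Iic 0}.piecewise L R) := by
    refine hB _ (wedgeTriangulation e e') c _ fun T ξ hξ => ?_
    have hpos := (mem_interior_refTriangle_iff ξ).1 hξ
    have hT : ∀ T : Fin 2, T = 0 ∨ T = 1 := by
      intro T
      fin_cases T <;> simp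
    rcases hT T with rfl | rfl
    · change {y : Plane | y 0 ∈ Iic 0}.piecewise L R (wedgeMap (-1) e ξ) = _
      rw [piecewise_eq_of_mem]
      · simp only [hL, wedgeInv_wedgeMap (σ := -1) (by norm_num)]
      · simpa [wedgeMap] using (hpos (edgeOpp e)).le
    · change {y : Plane | y 0 ∈ Iic 0}.piecewise L R (wedgeMap 1 e' ξ) = _
      rw [piecewise_eq_of_notMem]
      · simp only [hR, wedgeInv_wedgeMap (σ := 1) (by norm_num)]
      · simpa [wedgeMap] using hpos (edgeOpp e')
  have := hmem.eq_of_piecewise isOpen_interior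
    ((contDiff_scalar_onElement (wedgeTriangulation e e') c (0 : Fin 2)).comp (contDiff_wedgeInv _ _))
    ((contDiff_scalar_onElement (wedgeTriangulation e e') c (1 : Fin 2)).comp (contDiff_wedgeInv _ _))
    rfl (mem_interior_bigTriangle ht)
  simpa [hL, hR, wedgeInv_edge] using this

theorem eq_on_Icc_of_polyEval {q r : MvPolynomial (Fin 2) ℝ} {e e' : Fin 3}
    (h : ∀ t ∈ Ioo (0 : ℝ) 1, polyEval q (edgeParam e t) = polyEval r (edgeParam e' t)) :
    ∀ t ∈ Icc (0 : ℝ) 1, polyEval q (edgeParam e t) = polyEval r (edgeParam e' t) := by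
  have hc : ∀ (q : MvPolynomial (Fin 2) ℝ) e, Continuous fun t => polyEval q (edgeParam e t) :=
    fun q e => (contDiff_polyEval (n := 0) q).continuous.comp (continuous_edgeParam e)
  have := EqOn.closure (s := Ioo (0 : ℝ) 1) h (hc q e) (hc r e')
  rwa [closure_Ioo zero_ne_one] at this

theorem edgeParam_mem_refEdge (e : Fin 3) {t : ℝ} (ht : t ∈ Icc (0 : ℝ) 1) :
    edgeParam e t ∈ refEdge e := by
  rw [refEdge_eq_image]; exact mem_image_of_mem _ ht

theorem IsH1Conforming.trace_eq (hB : IsH1Conforming B) (e e' : Fin 3) (a b : ℝ)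
    (d : Fin (p - 1) → ℝ) {t : ℝ} (ht : t ∈ Ioo (0 : ℝ) 1) :
    a * polyEval (B.vertexFn (edgeFst e)) (edgeParam e t) +
      b * polyEval (B.vertexFn (edgeSnd e)) (edgeParam e t) +
      ∑ k, d k * polyEval (B.edgeFn e k) (edgeParam e t) =
    a * polyEval (B.vertexFn (edgeFst e')) (edgeParam e' t) +
      b * polyEval (B.vertexFn (edgeSnd e')) (edgeParam e' t) +
      ∑ k, d k * polyEval (B.edgeFn e' k) (edgeParam e' t) := by
  have h := hB.onElement_eq e e'
    ⟨fun v => if v = 10 then a else b, fun _ _ k => d k, fun _ _ => 0⟩ ht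
  have ht' := Ioo_subset_Icc_self ht
  replace h := (scalar_onElement_edge _ _ _ e (edgeParam_mem_refEdge e ht')).symm.trans
    (h.trans (scalar_onElement_edge _ _ _ e' (edgeParam_mem_refEdge e' ht')))
  have h1 : (wedgeTriangulation e e').vtx (0 : Fin 2) = wedgeVtx 0 e := rfl
  have h2 : (wedgeTriangulation e e').vtx (1 : Fin 2) = wedgeVtx 1 e' := rfl
  simpa [h1, h2, wedgeVtx_fst, wedgeVtx_snd] using h

theorem IsH1Conforming.vertexFn_fst_eq (hB : IsH1Conforming B) (e e' : Fin 3) :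
    ∀ t ∈ Icc (0 : ℝ) 1, polyEval (B.vertexFn (edgeFst e)) (edgeParam e t) =
      polyEval (B.vertexFn (edgeFst e')) (edgeParam e' t) :=
  eq_on_Icc_of_polyEval fun t ht => by simpa using hB.trace_eq e e' 1 0 0 ht

theorem IsH1Conforming.vertexFn_snd_eq (hB : IsH1Conforming B) (e e' : Fin 3) :
    ∀ t ∈ Icc (0 : ℝ) 1, polyEval (B.vertexFn (edgeSnd e)) (edgeParam e t) =
      polyEval (B.vertexFn (edgeSnd e')) (edgeParam e' t) :=
  eq_on_Icc_of_polyEval fun t ht => by simpa using hB.trace_eq e e' 0 1 0 ht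

theorem IsH1Conforming.edgeFn_eq (hB : IsH1Conforming B) (e e' : Fin 3) (k : Fin (p - 1)) :
    ∀ t ∈ Icc (0 : ℝ) 1, polyEval (B.edgeFn e k) (edgeParam e t) =
      polyEval (B.edgeFn e' k) (edgeParam e' t) :=
  eq_on_Icc_of_polyEval fun t ht => by
    simpa [Pi.single_apply] using hB.trace_eq e e' 0 0 (Pi.single k 1) ht

end TriNedelec

namespace TriNedelec
open MeasureTheory Set Filter Topology

theorem eq_single_add_single (u : Plane) :
    u = u 0 • EuclideanSpace.single 0 1 + u 1 • EuclideanSpace.single 1 1 := by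
  apply plane_ext <;> simp

theorem det_plane (f : Plane →L[ℝ] Plane) :
    f.det = f (EuclideanSpace.single 0 1) 0 * f (EuclideanSpace.single 1 1) 1 -
      f (EuclideanSpace.single 1 1) 0 * f (EuclideanSpace.single 0 1) 1 := by
  rw [ContinuousLinearMap.det, ← LinearMap.det_toMatrix (EuclideanSpace.basisFun (Fin 2) ℝ).toBasis,
    Matrix.det_fin_two]
  simp [LinearMap.toMatrix_apply]

/-- The determinant of two vectors of the plane. -/
def cross (u v : Plane) : ℝ := u 0 * v 1 - u 1 * v 0

theorem cross_map (f : Plane →L[ℝ] Plane) (u v : Plane) :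
    cross (f u) (f v) = f.det * cross u v := by
  rw [det_plane]
  conv_lhs => rw [eq_single_add_single u, eq_single_add_single v]
  simp only [cross, map_add, map_smul, PiLp.add_apply, PiLp.smul_apply, smul_eq_mul]
  ring

theorem edgeSign_mul_self (e : Fin 3) : (edgeSign e : ℝ) * edgeSign e = 1 := by
  fin_cases e <;> simp [edgeSign]

theorem hasFDerivAt_refBary_opp (e : Fin 3) (ξ : Plane) :
    ∃ L : Plane →L[ℝ] ℝ, HasFDerivAt (refBary (edgeOpp e)) L ξ ∧
      ∀ u, L u = - edgeSign e * cross (refTangent e) u := by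
  have h0 : HasFDerivAt (fun ξ : Plane => ξ 0) (EuclideanSpace.proj 0 : Plane →L[ℝ] ℝ) ξ :=
    (EuclideanSpace.proj 0 : Plane →L[ℝ] ℝ).hasFDerivAt
  have h1 : HasFDerivAt (fun ξ : Plane => ξ 1) (EuclideanSpace.proj 1 : Plane →L[ℝ] ℝ) ξ :=
    (EuclideanSpace.proj 1 : Plane →L[ℝ] ℝ).hasFDerivAt
  fin_cases e
  · exact ⟨_, h0, fun u => by
      simp [edgeSign, cross, refTangent, refVertex, edgeFst, edgeSnd, e₂]⟩
  · exact ⟨_, h1, fun u => by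
      simp [edgeSign, cross, refTangent, refVertex, edgeFst, edgeSnd, e₁]⟩
  · refine ⟨_, (h0.const_sub 1).sub h1, fun u => ?_⟩
    simp [edgeSign, cross, refTangent, refVertex, edgeFst, edgeSnd, e₁, e₂]
    ring

theorem eventually_pos_of_hasDerivAt {f : ℝ → ℝ} {c : ℝ} (hf : HasDerivAt f c 0) (h0 : f 0 = 0)
    (hc : 0 < c) : ∀ᶠ r in 𝓝[>] (0 : ℝ), 0 < f r := by
  have h := (hasDerivAt_iff_tendsto_slope.1 hf).mono_left
    (nhdsWithin_mono (0 : ℝ) (show Ioi (0 : ℝ) ⊆ {0}ᶜ from fun r hr => ne_of_gt hr))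
  filter_upwards [h.eventually (lt_mem_nhds hc), self_mem_nhdsWithin] with r hr hr0
  rw [slope_def_field, h0, sub_zero, sub_zero] at hr
  exact (div_pos_iff_of_pos_right hr0).1 hr

theorem IsElementMap.exists_localInverse {x : Plane → Plane} (hx : IsElementMap x) {ξ : Plane}
    (hξ : ξ ∈ refTriangle) : ∃ (J : Plane ≃L[ℝ] Plane) (g : Plane → Plane),
      (J : Plane →L[ℝ] Plane) = fderiv ℝ x ξ ∧ g (x ξ) = ξ ∧
      HasFDerivAt g (J.symm : Plane →L[ℝ] Plane) (x ξ) ∧ (∀ᶠ y in 𝓝 (x ξ), x (g y) = y) ∧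
      ∀ᶠ y in 𝓝 (x ξ), ∀ ζ ∈ refTriangle, x ζ = y → g y = ζ := by
  have hc := hx.contDiffAt ξ hξ
  set J := (fderiv ℝ x ξ).toContinuousLinearEquivOfDetNeZero (hx.det_ne_zero ξ hξ) with hJ
  have hJ' : (J : Plane →L[ℝ] Plane) = fderiv ℝ x ξ :=
    ContinuousLinearMap.coe_toContinuousLinearEquivOfDetNeZero _ _
  have hs : HasStrictFDerivAt x (J : Plane →L[ℝ] Plane) ξ := by
    rw [hJ']; exact hc.hasStrictFDerivAt one_ne_zero
  refine ⟨J, hs.localInverse x J ξ, hJ', hs.localInverse_apply_image,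
    hs.to_localInverse.hasFDerivAt, hs.eventually_right_inverse, ?_⟩
  obtain ⟨U, hU, hUo, hξU⟩ := eventually_nhds_iff.1 hs.eventually_left_inverse
  have hK : IsCompact (x '' (refTriangle \ U)) :=
    (isCompact_refTriangle.diff hUo).image_of_continuousOn fun ζ hζ =>
      (hx.contDiffAt ζ hζ.1).continuousAt.continuousWithinAt
  have hn : x ξ ∉ x '' (refTriangle \ U) := by
    rintro ⟨ζ, ⟨hζ, hζU⟩, h⟩
    rw [hx.injOn hζ hξ h] at hζU
    exact hζU hξU
  filter_upwards [hK.isClosed.isOpen_compl.mem_nhds hn] with y hy ζ hζ hζy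
  by_cases hζU : ζ ∈ U
  · rw [← hζy]; exact hU ζ hζU
  · exact absurd ⟨ζ, ⟨hζ, hζU⟩, hζy⟩ hy

variable {A : Set Plane} (M : Triangulation A)

/-- The edge `e` of the element `T` and the edge `e'` of `T'` have the same vertices. -/
def Triangulation.SameEdge (T : Fin M.m) (e : Fin 3) (T' : Fin M.m) (e' : Fin 3) : Prop :=
  M.vtx T (edgeFst e) = M.vtx T' (edgeFst e') ∧ M.vtx T (edgeSnd e) = M.vtx T' (edgeSnd e')

variable {M}

theorem Triangulation.SameEdge.symm {T T' : Fin M.m} {e e' : Fin 3} (h : M.SameEdge T e T' e') :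
    M.SameEdge T' e' T e := ⟨h.1.symm, h.2.symm⟩

theorem Triangulation.SameEdge.trans {T T' T'' : Fin M.m} {e e' e'' : Fin 3}
    (h : M.SameEdge T e T' e') (h' : M.SameEdge T' e' T'' e'') :
    M.SameEdge T e T'' e'' := ⟨h.1.trans h'.1, h.2.trans h'.2⟩

theorem edge_ext {e e' : Fin 3} (h : edgeFst e = edgeFst e') (h' : edgeSnd e = edgeSnd e') :
    e = e' := by
  fin_cases e <;> fin_cases e' <;> simp_all [edgeFst, edgeSnd]

theorem exists_edge {a b : Fin 3} (h : a < b) : ∃ e, edgeFst e = a ∧ edgeSnd e = b := by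
  fin_cases a <;> fin_cases b <;> simp at h
  · exact ⟨0, rfl, rfl⟩
  · exact ⟨1, rfl, rfl⟩
  · exact ⟨2, rfl, rfl⟩

theorem edgeFst_lt_edgeSnd (e : Fin 3) : edgeFst e < edgeSnd e := by
  fin_cases e <;> simp [edgeFst, edgeSnd]

theorem Triangulation.SameEdge.eq {T : Fin M.m} {e e' : Fin 3} (h : M.SameEdge T e T e') :
    e = e' :=
  edge_ext ((M.vtx_strictMono T).injective h.1) ((M.vtx_strictMono T).injective h.2)

theorem Triangulation.SameEdge.map_eq {T T' : Fin M.m} {e e' : Fin 3} (h : M.SameEdge T e T' e')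
    {t : ℝ} (ht : t ∈ Icc (0 : ℝ) 1) :
    M.map T (edgeParam e t) = M.map T' (edgeParam e' t) := by
  rw [M.conforming T T' _ (edgeParam_mem_refTriangle e ht) _ (edgeParam_mem_refTriangle e' ht)]
  funext v
  rw [globalBary_eq _ e, globalBary_eq _ e', h.1, h.2]
  simp only [refBary_fst_edgeParam, refBary_snd_edgeParam, refBary_opp_edgeParam, ite_self]

theorem globalBary_ne_zero {s : Fin 3 → ℕ} {ξ : Plane} {v : ℕ} (h : globalBary s ξ v ≠ 0) :
    ∃ a, s a = v := by
  by_contra! hn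
  exact h (Finset.sum_eq_zero fun a _ => if_neg (hn a))

theorem Triangulation.globalBary_apply (T : Fin M.m) (ξ : Plane) (a : Fin 3) :
    globalBary (M.vtx T) ξ (M.vtx T a) = refBary a ξ :=
  TriNedelec.globalBary_apply (M.vtx_strictMono T).injective ξ a

theorem Triangulation.exists_sameEdge {T T' : Fin M.m} {e : Fin 3} {t : ℝ}
    (ht : t ∈ Ioo (0 : ℝ) 1) {ζ : Plane} (hζ : ζ ∈ refTriangle)
    (h : M.map T (edgeParam e t) = M.map T' ζ) :
    ∃ e', M.SameEdge T e T' e' ∧ ζ = edgeParam e' t := by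
  have hg := (M.conforming T T' _ (edgeParam_mem_refTriangle e (Ioo_subset_Icc_self ht)) _ hζ).1 h
  have hf : globalBary (M.vtx T') ζ (M.vtx T (edgeFst e)) = 1 - t := by
    rw [← hg, M.globalBary_apply, refBary_fst_edgeParam]
  have hs : globalBary (M.vtx T') ζ (M.vtx T (edgeSnd e)) = t := by
    rw [← hg, M.globalBary_apply, refBary_snd_edgeParam]
  obtain ⟨a, ha⟩ := globalBary_ne_zero (hf ▸ (sub_pos.2 ht.2).ne')
  obtain ⟨b, hb⟩ := globalBary_ne_zero (hs ▸ ht.1.ne')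
  have hab : a < b := by
    rw [← (M.vtx_strictMono T').lt_iff_lt, ha, hb]
    exact M.vtx_strictMono T (edgeFst_lt_edgeSnd e)
  obtain ⟨e', rfl, rfl⟩ := exists_edge hab
  refine ⟨e', ⟨ha.symm, hb.symm⟩, ?_⟩
  rw [← ha, M.globalBary_apply] at hf
  rw [← hb, M.globalBary_apply] at hs
  have hsum := sum_vertex e' fun a => refBary a ζ
  rw [Fin.sum_univ_three, refBary_sum, hf, hs] at hsum
  have := eq_edgeParam_of_refBary_opp e' (ξ := ζ) (by linarith)
  rwa [hs] at this

theorem hasDerivAt_edgeParam (e : Fin 3) (t : ℝ) : HasDerivAt (edgeParam e) (refTangent e) t := by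
  unfold edgeParam
  simpa using ((hasDerivAt_id t).smul_const (refTangent e)).const_add (refVertex (edgeFst e))

theorem IsElementMap.hasFDerivAt {x : Plane → Plane} (hx : IsElementMap x) {ξ : Plane}
    (hξ : ξ ∈ refTriangle) : HasFDerivAt x (fderiv ℝ x ξ) ξ :=
  ((hx.contDiffAt ξ hξ).differentiableAt one_ne_zero).hasFDerivAt

theorem Triangulation.SameEdge.physTangent_eq {T T' : Fin M.m} {e e' : Fin 3}
    (h : M.SameEdge T e T' e') {t : ℝ} (ht : t ∈ Icc (0 : ℝ) 1) :
    physTangent (M.map T) e (edgeParam e t) = physTangent (M.map T') e' (edgeParam e' t) := by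
  have hd : ∀ T e, HasDerivWithinAt (fun t => M.map T (edgeParam e t))
      (physTangent (M.map T) e (edgeParam e t)) (Icc 0 1) t := fun T e =>
    (((M.isElementMap T).hasFDerivAt (edgeParam_mem_refTriangle e ht)).comp_hasDerivAt t
      (hasDerivAt_edgeParam e t)).hasDerivWithinAt
  exact (uniqueDiffOn_Icc_zero_one t ht).eq_deriv _ (hd T e)
    ((hd T' e').congr_of_mem (fun s hs => h.map_eq hs) ht)

/-- The ratio of the orientations of two elements sharing an edge, relative to that edge. -/
noncomputable def Triangulation.edgeRatio (M : Triangulation A) (T : Fin M.m) (e : Fin 3)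
    (T' : Fin M.m) (e' : Fin 3) (t : ℝ) : ℝ :=
  (edgeSign e : ℝ) * edgeSign e' * (fderiv ℝ (M.map T) (edgeParam e t)).det /
    (fderiv ℝ (M.map T') (edgeParam e' t)).det

/-- If a segment leaves the edge `e` of `T` towards the opposite vertex with speed `r`, then its
image, pulled back to a neighbouring element, leaves the common edge with speed proportional to
`edgeRatio`. -/
theorem Triangulation.SameEdge.hasDerivAt_pullback {T T' : Fin M.m} {e e' : Fin 3}
    (h : M.SameEdge T e T' e') {t : ℝ} (ht : t ∈ Icc (0 : ℝ) 1) {J : Plane ≃L[ℝ] Plane}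
    {g : Plane → Plane} (hJ : (J : Plane →L[ℝ] Plane) = fderiv ℝ (M.map T') (edgeParam e' t))
    (hg0 : g (M.map T' (edgeParam e' t)) = edgeParam e' t)
    (hg : HasFDerivAt g (J.symm : Plane →L[ℝ] Plane) (M.map T' (edgeParam e' t))) (c : ℝ) :
    HasDerivAt (fun r : ℝ => refBary (edgeOpp e') (g (M.map T (edgeParam e t +
      (c * r) • (edgeParam e t - refVertex (edgeOpp e)))))) (- c * M.edgeRatio T e T' e' t) 0 := by
  obtain ⟨L', hL', hL'u⟩ := hasFDerivAt_refBary_opp e' (edgeParam e' t)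
  obtain ⟨L, hL, hLu⟩ := hasFDerivAt_refBary_opp e (edgeParam e t)
  set n := edgeParam e t - refVertex (edgeOpp e) with hn
  have hline : ∀ c : ℝ, HasDerivAt (fun r : ℝ => edgeParam e t + (c * r) • n) (c • n) 0 := by
    intro c
    have := ((((hasDerivAt_id (0 : ℝ)).const_mul c).smul_const n).const_add (edgeParam e t))
    simpa using this
  have hLn : L n = -1 := by
    have h1 := HasFDerivAt.comp_hasDerivAt (f := fun r : ℝ => edgeParam e t + ((1 : ℝ) * r) • n) 0
      (by simpa using hL) (hline 1)
    have h2 : HasDerivAt (refBary (edgeOpp e) ∘ fun r : ℝ => edgeParam e t + ((1 : ℝ) * r) • n)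
        (-1) 0 := by
      have : (refBary (edgeOpp e) ∘ fun r : ℝ => edgeParam e t + ((1 : ℝ) * r) • n) =
          fun r => -r := by
        funext r
        rw [Function.comp_apply, hn, refBary_lineMap, refBary_opp_edgeParam]
        simp
      rw [this]
      exact (hasDerivAt_id (0 : ℝ)).neg
    simpa using h1.unique h2
  have htan := h.physTangent_eq ht
  set J₁ := fderiv ℝ (M.map T) (edgeParam e t) with hJ₁
  have hdet : (fderiv ℝ (M.map T') (edgeParam e' t)).det ≠ 0 :=
    (M.isElementMap T').det_ne_zero _ (edgeParam_mem_refTriangle e' ht)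
  have hval : L' (J.symm (J₁ n)) = - M.edgeRatio T e T' e' t := by
    have h1 := cross_map (J : Plane →L[ℝ] Plane) (refTangent e') (J.symm (J₁ n))
    have h2 := cross_map J₁ (refTangent e) n
    rw [hJ] at h1
    have h3 : (fderiv ℝ (M.map T') (edgeParam e' t)) (J.symm (J₁ n)) = J₁ n := by
      rw [← hJ]; simp
    rw [h3] at h1
    have h4 : (fderiv ℝ (M.map T') (edgeParam e' t)) (refTangent e') = J₁ (refTangent e) :=
      htan.symm
    rw [h4, h2] at h1
    rw [hL'u, Triangulation.edgeRatio, ← neg_div, eq_div_iff hdet]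
    have h5 := hLu n
    rw [hLn] at h5
    have h6 := edgeSign_mul_self e
    have h7 : cross (refTangent e) n = edgeSign e := by
      linear_combination (edgeSign e : ℝ) * h5 - (cross (refTangent e) n) * h6
    rw [h7] at h1
    rw [← hJ₁]
    linear_combination (edgeSign e' : ℝ) * h1
  have hx := ((M.isElementMap T).hasFDerivAt (edgeParam_mem_refTriangle e ht))
  have hx1 := HasFDerivAt.comp_hasDerivAt (f := fun r : ℝ => edgeParam e t + (c * r) • n) 0
    (by simpa using hx) (hline c)
  have hmap := h.map_eq ht
  have hg1 := HasFDerivAt.comp_hasDerivAt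
    (f := M.map T ∘ fun r : ℝ => edgeParam e t + (c * r) • n) 0
    (by simpa [hmap] using hg) hx1
  have hb := HasFDerivAt.comp_hasDerivAt
    (f := g ∘ M.map T ∘ fun r : ℝ => edgeParam e t + (c * r) • n) 0
    (by simpa [hmap, hg0] using hL') hg1
  have hcomp : L' (J.symm (J₁ (c • n))) = - c * M.edgeRatio T e T' e' t := by
    rw [map_smul, map_smul, map_smul, hval, smul_eq_mul]
    ring
  rw [← hcomp]
  exact hb

theorem edgeRatio_ne_zero {T T' : Fin M.m} {e e' : Fin 3} {t : ℝ} (ht : t ∈ Icc (0 : ℝ) 1) :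
    M.edgeRatio T e T' e' t ≠ 0 := by
  have hs : ∀ e, (edgeSign e : ℝ) ≠ 0 := fun e h => by
    have := edgeSign_mul_self e
    simp [h] at this
  exact div_ne_zero (mul_ne_zero (mul_ne_zero (hs e) (hs e'))
    ((M.isElementMap T).det_ne_zero _ (edgeParam_mem_refTriangle e ht)))
    ((M.isElementMap T').det_ne_zero _ (edgeParam_mem_refTriangle e' ht))

theorem Triangulation.eq_of_map_eq_of_pos {T T' : Fin M.m} {ξ ξ' : Plane}
    (hξ : ∀ a, 0 < refBary a ξ) (hξ' : ∀ a, 0 < refBary a ξ') (h : M.map T ξ = M.map T' ξ') :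
    T = T' := by
  have hg := (M.conforming T T' ξ ((mem_refTriangle_iff ξ).2 fun a => (hξ a).le) ξ'
    ((mem_refTriangle_iff ξ').2 fun a => (hξ' a).le)).1 h
  have hr : ∀ T ξ, (∀ a, 0 < refBary a ξ) →
      range (M.vtx T) = {v | globalBary (M.vtx T) ξ v ≠ 0} := by
    intro T ξ hξ
    ext v
    constructor
    · rintro ⟨a, rfl⟩
      change globalBary (M.vtx T) ξ (M.vtx T a) ≠ 0
      rw [M.globalBary_apply]
      exact (hξ a).ne'
    · exact globalBary_ne_zero
  apply M.vtx_injective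
  rw [← (M.vtx_strictMono T).range_inj (M.vtx_strictMono T'), hr T ξ hξ, hr T' ξ' hξ', hg]

/-- Two different elements lie on different sides of a common edge. -/
theorem Triangulation.SameEdge.edgeRatio_neg {T T' : Fin M.m} {e e' : Fin 3}
    (h : M.SameEdge T e T' e') (hT : T ≠ T') {t : ℝ} (ht : t ∈ Ioo (0 : ℝ) 1) :
    M.edgeRatio T e T' e' t < 0 := by
  have ht' := Ioo_subset_Icc_self ht
  refine lt_of_le_of_ne (not_lt.1 fun hpos => hT ?_) (edgeRatio_ne_zero ht')
  obtain ⟨J, g, hJ, hg0, hg, hright, -⟩ :=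
    (M.isElementMap T').exists_localInverse (edgeParam_mem_refTriangle e' ht')
  have hopp := eventually_pos_of_hasDerivAt (h.hasDerivAt_pullback ht' hJ hg0 hg (-1))
    (by simp [h.map_eq ht', hg0, refBary_opp_edgeParam]) (by linarith)
  set y : ℝ → Plane := fun r => M.map T (edgeParam e t +
      (-1 * r) • (edgeParam e t - refVertex (edgeOpp e))) with hy
  have hy0 : y 0 = M.map T' (edgeParam e' t) := by simp [hy, h.map_eq ht']
  have hyc : ContinuousAt y 0 := by
    have hx := ((M.isElementMap T).hasFDerivAt (edgeParam_mem_refTriangle e ht')).continuousAt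
    refine ContinuousAt.comp (f := fun r : ℝ => edgeParam e t +
      (-1 * r) • (edgeParam e t - refVertex (edgeOpp e))) (by simpa using hx) ?_
    fun_prop
  have hyt : Tendsto y (𝓝[>] 0) (𝓝 (M.map T' (edgeParam e' t))) := by
    rw [← hy0]; exact hyc.tendsto.mono_left nhdsWithin_le_nhds
  have hgt : Tendsto (fun r => g (y r)) (𝓝[>] 0) (𝓝 (edgeParam e' t)) := by
    have := hg.continuousAt.tendsto.comp hyt
    rwa [hg0] at this
  have hb : ∀ a, Tendsto (fun r => refBary a (g (y r))) (𝓝[>] 0)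
      (𝓝 (refBary a (edgeParam e' t))) := fun a =>
    ((continuous_refBary a).tendsto _).comp hgt
  have hfst := (hb (edgeFst e')).eventually (lt_mem_nhds
    (by rw [refBary_fst_edgeParam]; exact sub_pos.2 ht.2))
  have hsnd := (hb (edgeSnd e')).eventually (lt_mem_nhds
    (by rw [refBary_snd_edgeParam]; exact ht.1))
  have hr1 : ∀ᶠ r : ℝ in 𝓝[>] 0, r < 1 := nhdsWithin_le_nhds (gt_mem_nhds one_pos)
  obtain ⟨r, hro, hrf, hrs, hrr, hr1, hr0⟩ := (hopp.and (hfst.and (hsnd.and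
    ((hyt.eventually hright).and (hr1.and self_mem_nhdsWithin))))).exists
  have hr0 : 0 < r := hr0
  refine M.eq_of_map_eq_of_pos (ξ' := g (y r)) ?_
    ((forall_vertex_iff e').2 ⟨hrf, hrs, hro⟩) hrr.symm
  have hne1 : edgeFst e ≠ edgeOpp e := by fin_cases e <;> simp [edgeFst, edgeOpp]
  have hne2 : edgeSnd e ≠ edgeOpp e := by fin_cases e <;> simp [edgeSnd, edgeOpp]
  refine (forall_vertex_iff e).2 ⟨?_, ?_, ?_⟩
  · rw [refBary_lineMap, refBary_fst_edgeParam, if_neg hne1]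
    nlinarith [mul_pos (sub_pos.2 ht.2) (sub_pos.2 hr1)]
  · rw [refBary_lineMap, refBary_snd_edgeParam, if_neg hne2]
    nlinarith [mul_pos ht.1 (sub_pos.2 hr1)]
  · rw [refBary_lineMap, refBary_opp_edgeParam, if_pos rfl]
    linarith

/-- An edge point in the open set `A` has elements on both sides. -/
theorem Triangulation.exists_neighbour (T : Fin M.m) (e : Fin 3) {t : ℝ} (ht : t ∈ Ioo (0 : ℝ) 1)
    (hA : M.map T (edgeParam e t) ∈ A) :
    ∃ T' e', M.SameEdge T e T' e' ∧ M.edgeRatio T e T' e' t < 0 := by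
  have ht' := Ioo_subset_Icc_self ht
  set y : ℝ → Plane := fun r => M.map T (edgeParam e t +
      (1 * r) • (edgeParam e t - refVertex (edgeOpp e))) with hy
  have hyc : ContinuousAt y 0 := by
    have hx := ((M.isElementMap T).hasFDerivAt (edgeParam_mem_refTriangle e ht')).continuousAt
    refine ContinuousAt.comp (f := fun r : ℝ => edgeParam e t +
      (1 * r) • (edgeParam e t - refVertex (edgeOpp e))) (by simpa using hx) ?_
    fun_prop
  have hyt : Tendsto y (𝓝[>] 0) (𝓝 (M.map T (edgeParam e t))) := by
    have := hyc.tendsto.mono_left (nhdsWithin_le_nhds (s := Ioi 0))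
    simpa [hy] using this
  have hcov : ∀ᶠ r in 𝓝[>] 0, ∃ T', y r ∈ M.map T' '' refTriangle := by
    filter_upwards [hyt.eventually (M.isOpen.mem_nhds hA)] with r hr
    have := subset_closure hr
    rw [← M.covers] at this
    exact mem_iUnion.1 this
  obtain ⟨T', hT'⟩ : ∃ T', ∃ᶠ r in 𝓝[>] 0, y r ∈ M.map T' '' refTriangle := by
    by_contra! hn
    have : ∀ᶠ r in 𝓝[>] (0 : ℝ), ∀ T', y r ∉ M.map T' '' refTriangle :=
      eventually_all.2 hn
    obtain ⟨r, hr, T', hr'⟩ := (this.and hcov).exists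
    exact hr T' hr'
  have hcl : IsClosed (M.map T' '' refTriangle) :=
    (isCompact_refTriangle.image_of_continuousOn fun ζ hζ =>
      ((M.isElementMap T').contDiffAt ζ hζ).continuousAt.continuousWithinAt).isClosed
  obtain ⟨ζ, hζ, hζy⟩ := hcl.closure_eq ▸ mem_closure_of_frequently_of_tendsto hT' hyt
  obtain ⟨e', hE, rfl⟩ := M.exists_sameEdge ht hζ hζy.symm
  refine ⟨T', e', hE, lt_of_le_of_ne (not_lt.1 fun hpos => ?_) (edgeRatio_ne_zero ht')⟩
  obtain ⟨J, g, hJ, hg0, hg, -, hleft⟩ := (M.isElementMap T').exists_localInverse hζ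
  have hopp := eventually_pos_of_hasDerivAt (hE.hasDerivAt_pullback ht' hJ hg0 hg 1).neg
    (by simp [hE.map_eq ht', hg0, refBary_opp_edgeParam]) (by linarith)
  rw [← hζy] at hyt
  obtain ⟨r, ⟨ζ', hζ', hζr⟩, hro, hrl⟩ := (hT'.and_eventually
    (hopp.and (hyt.eventually hleft))).exists
  have h1 := (mem_refTriangle_iff ζ').1 hζ' (edgeOpp e')
  rw [← hrl ζ' hζ' hζr] at h1
  simp only [Pi.neg_apply] at hro
  linarith

variable {p : ℕ} {B : PolytopalBasis p}

theorem IsH1Conforming.inner_onElement_eq (hB : IsH1Conforming B) {T T' : Fin M.m} {e e' : Fin 3}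
    (h : M.SameEdge T e T' e') (c : NedelecCoeffs p M.m) {t : ℝ} (ht : t ∈ Icc (0 : ℝ) 1) :
    inner ℝ (refTangent e) (c.onElement B M T (edgeParam e t)) =
      inner ℝ (refTangent e') (c.onElement B M T' (edgeParam e' t)) := by
  rw [inner_onElement M c T e (edgeParam_mem_refEdge e ht),
    inner_onElement M c T' e' (edgeParam_mem_refEdge e' ht), h.1, h.2,
    hB.vertexFn_fst_eq e e' t ht, hB.vertexFn_snd_eq e e' t ht]
  simp only [hB.edgeFn_eq e e' _ t ht]

theorem IsH1Conforming.hasContinuousTangentialTrace (hB : IsH1Conforming B) :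
    HasContinuousTangentialTrace B := by
  intro A M c T T' e e' hf hs ξ hξ ξ' hξ' hmap
  have h : M.SameEdge T e T' e' := ⟨hf, hs⟩
  rw [refEdge_eq_image] at hξ hξ'
  obtain ⟨t, ht, rfl⟩ := hξ
  obtain ⟨t', ht', rfl⟩ := hξ'
  have hm := edgeParam_mem_refTriangle e ht
  have hm' := edgeParam_mem_refTriangle e' ht'
  obtain rfl : t = t' := by
    have hg := congrFun ((M.conforming T T' _ hm _ hm').1 hmap) (M.vtx T (edgeSnd e))
    rw [M.globalBary_apply, refBary_snd_edgeParam, hs, M.globalBary_apply,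
      refBary_snd_edgeParam] at hg
    exact hg
  rw [(M.isElementMap T).inner_physTangent e _ hm, h.physTangent_eq ht,
    (M.isElementMap T').inner_physTangent e' _ hm', hB.inner_onElement_eq h c ht]

end TriNedelec

namespace TriNedelec
open MeasureTheory Set Filter Topology

theorem sum_eq_zero_of_partner {ι : Type*} [Fintype ι] {f : ι → ℝ} {P : ι → ι → Prop}
    (hex : ∀ i, f i ≠ 0 → ∃ j, P i j) (hsymm : ∀ i j, P i j → P j i)
    (huniq : ∀ i j k, P i j → P i k → j = k) (hf : ∀ i j, P i j → f i + f j = 0) :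
    ∑ i, f i = 0 := by
  classical
  rw [← Finset.sum_filter_ne_zero]
  have hmem : ∀ {i}, i ∈ Finset.univ.filter (fun i => f i ≠ 0) → f i ≠ 0 := fun h =>
    (Finset.mem_filter.1 h).2
  have hspec := fun i (h : i ∈ Finset.univ.filter (fun i => f i ≠ 0)) =>
    (hex i (hmem h)).choose_spec
  have hne : ∀ i h, f ((hex i (hmem h)).choose) ≠ 0 := fun i h h0 => by
    have := hf _ _ (hspec i h)
    rw [h0, add_zero] at this
    exact hmem h this
  refine Finset.sum_involution (fun i h => (hex i (hmem h)).choose)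
    (fun i h => hf _ _ (hspec i h)) (fun i h _ heq => ?_)
    (fun i h => Finset.mem_filter.2 ⟨Finset.mem_univ _, hne i h⟩) (fun i h => ?_)
  · have h1 := hf _ _ (hspec i h)
    rw [heq] at h1
    exact hmem h (by linarith)
  · exact huniq _ _ _ (hspec _ (Finset.mem_filter.2 ⟨Finset.mem_univ _, hne i h⟩)) (hsymm _ _ (hspec i h))

theorem convex_refTriangle : Convex ℝ refTriangle := by
  intro x hx y hy a b ha hb hab
  rw [mem_refTriangle_iff] at *
  intro i
  have h : refBary i (a • x + b • y) = a * refBary i x + b * refBary i y := by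
    fin_cases i <;> simp [refBary]
    linear_combination -hab
  rw [h]
  exact add_nonneg (mul_nonneg ha (hx i)) (mul_nonneg hb (hy i))

theorem volume_refTriangle_diff_interior : volume (refTriangle \ interior refTriangle) = 0 := by
  rw [← isClosed_refTriangle.frontier_eq]
  exact convex_refTriangle.addHaar_frontier _

namespace IsElementMap

variable {x : Plane → Plane}

theorem continuousOn (hx : IsElementMap x) : ContinuousOn x refTriangle := fun ζ hζ =>
  (hx.contDiffAt ζ hζ).continuousAt.continuousWithinAt

theorem continuousOn_fderiv (hx : IsElementMap x) : ContinuousOn (fderiv ℝ x) refTriangle := fun ζ hζ =>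
  ((hx.contDiffAt ζ hζ).continuousAt_fderiv one_ne_zero).continuousWithinAt

theorem volume_image_diff_interior (hx : IsElementMap x) :
    volume (x '' (refTriangle \ interior refTriangle)) = 0 :=
  addHaar_image_eq_zero_of_differentiableOn_of_addHaar_eq_zero _
    (fun _ hζ => (hx.hasFDerivAt hζ.1).differentiableAt.differentiableWithinAt)
    volume_refTriangle_diff_interior

theorem measurableSet_image_interior (hx : IsElementMap x) : MeasurableSet (x '' interior refTriangle) :=
  isOpen_interior.measurableSet.image_of_continuousOn_injOn
    (hx.continuousOn.mono interior_subset) (hx.injOn.mono interior_subset)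

theorem continuousOn_invFunOn (hx : IsElementMap x) :
    ContinuousOn (Function.invFunOn x refTriangle) (x '' refTriangle) := by
  rintro _ ⟨ξ, hξ, rfl⟩
  obtain ⟨J, g, -, hg0, hg, -, hleft⟩ := hx.exists_localInverse hξ
  have h : ∀ y ∈ x '' refTriangle, (∀ ζ ∈ refTriangle, x ζ = y → g y = ζ) →
      Function.invFunOn x refTriangle y = g y := fun y hy h =>
    (h _ (Function.invFunOn_mem hy) (Function.invFunOn_eq hy)).symm
  refine hg.continuousAt.continuousWithinAt.congr_of_eventuallyEq ?_
    (h _ (mem_image_of_mem _ hξ) hleft.self_of_nhds)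
  filter_upwards [self_mem_nhdsWithin, mem_nhdsWithin_of_mem_nhds hleft] with y hy hl
  exact h y hy hl

theorem invFunOn_apply (hx : IsElementMap x) {ξ : Plane} (hξ : ξ ∈ refTriangle) :
    Function.invFunOn x refTriangle (x ξ) = ξ :=
  hx.injOn (Function.invFunOn_mem (mem_image_of_mem _ hξ)) hξ
    (Function.invFunOn_eq (mem_image_of_mem _ hξ))

theorem exists_sign (hx : IsElementMap x) : ∃ s : ℝ, s * s = 1 ∧
    ∀ ξ ∈ refTriangle, |(fderiv ℝ x ξ).det| = s * (fderiv ℝ x ξ).det := by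
  have hc : ContinuousOn (fun ξ => (fderiv ℝ x ξ).det) refTriangle :=
    ContinuousLinearMap.continuous_det.comp_continuousOn hx.continuousOn_fderiv
  have hpre := convex_refTriangle.isPreconnected
  by_cases hneg : ∃ ξ ∈ refTriangle, (fderiv ℝ x ξ).det < 0
  · obtain ⟨ξ, hξ, hn⟩ := hneg
    refine ⟨-1, by norm_num, fun ζ hζ => ?_⟩
    rw [neg_one_mul, abs_of_nonpos]
    by_contra! hp
    obtain ⟨z, hz, hz0⟩ := hpre.intermediate_value hξ hζ hc ⟨hn.le, hp.le⟩
    exact hx.det_ne_zero z hz hz0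
  · push Not at hneg
    exact ⟨1, by norm_num, fun ζ hζ => by rw [one_mul, abs_of_nonneg (hneg ζ hζ)]⟩

theorem isInvertible_adjoint (hx : IsElementMap x) {ξ : Plane} (hξ : ξ ∈ refTriangle) :
    (ContinuousLinearMap.adjoint (fderiv ℝ x ξ)).IsInvertible := by
  set J := (fderiv ℝ x ξ).toContinuousLinearEquivOfDetNeZero (hx.det_ne_zero ξ hξ)
  have hJ : (J : Plane →L[ℝ] Plane) = fderiv ℝ x ξ :=
    ContinuousLinearMap.coe_toContinuousLinearEquivOfDetNeZero _ _
  rw [← hJ]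
  refine ⟨ContinuousLinearEquiv.equivOfInverse (ContinuousLinearMap.adjoint (J : Plane →L[ℝ] Plane))
    (ContinuousLinearMap.adjoint (J.symm : Plane →L[ℝ] Plane)) ?_ ?_, rfl⟩
  · intro u
    refine ext_inner_left ℝ fun v => ?_
    rw [ContinuousLinearMap.adjoint_inner_right, ContinuousLinearMap.adjoint_inner_right]
    simp
  · intro u
    refine ext_inner_left ℝ fun v => ?_
    rw [ContinuousLinearMap.adjoint_inner_right, ContinuousLinearMap.adjoint_inner_right]
    simp

theorem continuousOn_covariantPiola (hx : IsElementMap x) {ϑ : Plane → Plane} (hϑ : Continuous ϑ) :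
    ContinuousOn (covariantPiola x ϑ) refTriangle := by
  intro ξ hξ
  have h1 : ContinuousWithinAt (fun ξ => ContinuousLinearMap.adjoint (fderiv ℝ x ξ))
      refTriangle ξ :=
    ContinuousLinearMap.adjoint.continuous.continuousAt.comp_continuousWithinAt
      (hx.continuousOn_fderiv ξ hξ)
  have h2 : ContinuousWithinAt (fun ξ => (ContinuousLinearMap.adjoint (fderiv ℝ x ξ)).inverse)
      refTriangle ξ :=
    ContinuousAt.comp_continuousWithinAt
      (f := fun ξ => ContinuousLinearMap.adjoint (fderiv ℝ x ξ))
      ((hx.isInvertible_adjoint hξ).contDiffAt_map_inverse (n := 0)).continuousAt h1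
  exact h2.clm_apply hϑ.continuousWithinAt

/-- The pull-back of the integrand of the weak rotation. -/
theorem piola_cross_grad (hx : IsElementMap x) {ϑ : Plane → Plane} {φ : Plane → ℝ} (hφ : Differentiable ℝ φ) {ξ : Plane}
    (hξ : ξ ∈ refTriangle) :
    (fderiv ℝ x ξ).det * (covariantPiola x ϑ ξ 0 * partialD 1 φ (x ξ) -
      covariantPiola x ϑ ξ 1 * partialD 0 φ (x ξ)) =
    ϑ ξ 0 * partialD 1 (φ ∘ x) ξ - ϑ ξ 1 * partialD 0 (φ ∘ x) ξ := by
  have hcomp : fderiv ℝ (φ ∘ x) ξ = (fderiv ℝ φ (x ξ)).comp (fderiv ℝ x ξ) :=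
    fderiv_comp ξ (hφ _) (hx.hasFDerivAt hξ).differentiableAt
  have hϑ : ∀ i, ϑ ξ i =
      inner ℝ (fderiv ℝ x ξ (EuclideanSpace.single i 1)) (covariantPiola x ϑ ξ) := by
    intro i
    rw [covariantPiola, inner_apply_adjoint_inverse (hx.det_ne_zero ξ hξ),
      EuclideanSpace.inner_single_left]
    simp
  have hφx : ∀ i, partialD i (φ ∘ x) ξ =
      fderiv ℝ x ξ (EuclideanSpace.single i 1) 0 * partialD 0 φ (x ξ) +
      fderiv ℝ x ξ (EuclideanSpace.single i 1) 1 * partialD 1 φ (x ξ) := by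
    intro i
    simp only [partialD]
    rw [hcomp, ContinuousLinearMap.comp_apply,
      eq_single_add_single (fderiv ℝ x ξ (EuclideanSpace.single i 1)), map_add, map_smul, map_smul]
    simp
  rw [hϑ 0, hϑ 1, hφx 0, hφx 1, inner_plane, inner_plane, det_plane]
  ring

/-- Change of variables on an element. -/
theorem setIntegral_image (hx : IsElementMap x) (H : Plane → ℝ) : ∫ y in x '' interior refTriangle, H y =
    ∫ ξ in refTriangle, |(fderiv ℝ x ξ).det| * H (x ξ) := by
  rw [integral_image_eq_integral_abs_det_fderiv_smul _ isOpen_interior.measurableSet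
    (fun ξ hξ => (hx.hasFDerivAt (interior_subset hξ)).hasFDerivWithinAt)
    (hx.injOn.mono interior_subset)]
  refine setIntegral_congr_set (interior_subset.eventuallyLE.antisymm ?_)
  exact ae_le_set.2 volume_refTriangle_diff_interior

end IsElementMap

variable {A : Set Plane} {M : Triangulation A}

/-- The union of the interiors of the elements. -/
def Triangulation.cells (M : Triangulation A) : Set Plane :=
  ⋃ T, M.map T '' interior refTriangle

theorem Triangulation.measurableSet_cells : MeasurableSet M.cells :=
  MeasurableSet.iUnion fun T => (M.isElementMap T).measurableSet_image_interior

theorem Triangulation.volume_diff_cells : volume (A \ M.cells) = 0 := by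
  refine measure_mono_null (t := ⋃ T, M.map T '' (refTriangle \ interior refTriangle)) ?_
    (measure_iUnion_null fun T => (M.isElementMap T).volume_image_diff_interior)
  rintro y ⟨hyA, hyW⟩
  have hy := subset_closure hyA
  rw [← M.covers] at hy
  obtain ⟨T, ξ, hξ, rfl⟩ := mem_iUnion.1 hy
  exact mem_iUnion.2 ⟨T, ξ, ⟨hξ, fun h => hyW (mem_iUnion.2 ⟨T, mem_image_of_mem _ h⟩)⟩, rfl⟩

theorem Triangulation.eq_of_mem_image_interior {T T' : Fin M.m} {ξ ξ' : Plane}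
    (hξ : ξ ∈ interior refTriangle) (hξ' : ξ' ∈ interior refTriangle)
    (h : M.map T ξ = M.map T' ξ') : T = T' :=
  M.eq_of_map_eq_of_pos ((mem_interior_refTriangle_iff ξ).1 hξ)
    ((mem_interior_refTriangle_iff ξ').1 hξ') h

theorem Triangulation.pairwise_disjoint :
    Pairwise (Function.onFun Disjoint fun T => M.map T '' interior refTriangle) := by
  intro T T' hT
  refine Set.disjoint_left.2 ?_
  rintro _ ⟨ξ, hξ, rfl⟩ ⟨ξ', hξ', h⟩
  exact hT (M.eq_of_mem_image_interior hξ hξ' h.symm)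

theorem Triangulation.volume_cells_lt_top : volume M.cells < ⊤ := by
  refine (measure_iUnion_fintype_le _ _).trans_lt (ENNReal.sum_lt_top.2 fun T _ => ?_)
  exact (measure_mono (image_mono interior_subset)).trans_lt
    (isCompact_refTriangle.image_of_continuousOn (M.isElementMap T).continuousOn).measure_lt_top

/-- A function that is continuous up to the boundary on each element is square integrable. -/
theorem Triangulation.memLp_cells {E : Type*} [NormedAddCommGroup E] {F : Plane → E}
    {q : Fin M.m → Plane → E} (hq : ∀ T, ContinuousOn (q T) refTriangle)
    (hF : ∀ T, ∀ ξ ∈ interior refTriangle, F (M.map T ξ) = q T ξ) :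
    MemLp F 2 (volume.restrict M.cells) := by
  have : IsFiniteMeasure (volume.restrict M.cells) :=
    ⟨by rw [Measure.restrict_apply_univ]; exact M.volume_cells_lt_top⟩
  have hbound : ∀ T, ∃ C, ∀ ξ ∈ refTriangle, ‖q T ξ‖ ≤ C := fun T =>
    isCompact_refTriangle.exists_bound_of_continuousOn (hq T)
  choose C hC using hbound
  have hmeas : AEStronglyMeasurable F (volume.restrict M.cells) := by
    refine aestronglyMeasurable_iUnion_iff.2 fun T => ?_
    have hx := M.isElementMap T
    have hc : ContinuousOn F (M.map T '' interior refTriangle) := by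
      have h1 : ContinuousOn (q T ∘ Function.invFunOn (M.map T) refTriangle)
          (M.map T '' interior refTriangle) :=
        (hq T).comp (hx.continuousOn_invFunOn.mono (image_mono interior_subset)) fun y hy =>
          Function.invFunOn_mem (image_mono interior_subset hy)
      refine h1.congr ?_
      rintro _ ⟨ξ, hξ, rfl⟩
      rw [hF T ξ hξ, Function.comp_apply, hx.invFunOn_apply (interior_subset hξ)]
    exact hc.aestronglyMeasurable_of_isSeparable hx.measurableSet_image_interior
      (TopologicalSpace.IsSeparable.of_separableSpace _)
  refine MemLp.of_bound hmeas (∑ T, |C T|) ?_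
  refine (ae_restrict_iff' M.measurableSet_cells).2 (Eventually.of_forall fun y hy => ?_)
  obtain ⟨T, ξ, hξ, rfl⟩ := mem_iUnion.1 hy
  rw [hF T ξ hξ]
  exact ((hC T ξ (interior_subset hξ)).trans (le_abs_self _)).trans
    (Finset.single_le_sum (f := fun T => |C T|) (fun _ _ => abs_nonneg _) (Finset.mem_univ T))

theorem Triangulation.memLp_of_cells {E : Type*} [NormedAddCommGroup E] {F : Plane → E}
    (h : MemLp F 2 (volume.restrict M.cells)) : MemLp F 2 (volume.restrict A) :=
  h.mono_measure (Measure.restrict_mono' (ae_le_set.2 M.volume_diff_cells) le_rfl)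

theorem Triangulation.setIntegral_eq_sum {H : Plane → ℝ} (hH : ∀ y ∉ A, H y = 0)
    (hi : IntegrableOn H M.cells) :
    ∫ y in A, H y = ∑ T, ∫ ξ in refTriangle, |(fderiv ℝ (M.map T) ξ).det| * H (M.map T ξ) := by
  rw [setIntegral_eq_integral_of_forall_compl_eq_zero hH,
    ← setIntegral_eq_integral_of_ae_compl_eq_zero (s := M.cells)]
  · rw [Triangulation.cells, integral_iUnion_fintype
      (fun T => (M.isElementMap T).measurableSet_image_interior) M.pairwise_disjoint
      fun T => hi.mono_set (subset_iUnion (fun T => M.map T '' interior refTriangle) T)]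
    exact Finset.sum_congr rfl fun T _ => (M.isElementMap T).setIntegral_image H
  · filter_upwards [compl_mem_ae_iff.2 (M.volume_diff_cells)] with y hy hyW
    by_contra h
    exact hy ⟨not_not.1 fun hA => h (hH y hA), hyW⟩

theorem Triangulation.exists_piecewise (q : Fin M.m → Plane → ℝ) :
    ∃ g : Plane → ℝ, ∀ T, ∀ ξ ∈ interior refTriangle, g (M.map T ξ) = q T ξ := by
  classical
  refine ⟨fun y => if h : ∃ z : Fin M.m × Plane, z.2 ∈ interior refTriangle ∧ M.map z.1 z.2 = y
    then q h.choose.1 h.choose.2 else 0, fun T ξ hξ => ?_⟩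
  have h : ∃ z : Fin M.m × Plane, z.2 ∈ interior refTriangle ∧ M.map z.1 z.2 = M.map T ξ :=
    ⟨(T, ξ), hξ, rfl⟩
  obtain ⟨h1, h2⟩ := h.choose_spec
  have hT := M.eq_of_mem_image_interior h1 hξ h2
  rw [hT] at h2
  refine (dif_pos h).trans ?_
  rw [hT, (M.isElementMap T).injOn (interior_subset h1) (interior_subset hξ) h2]

variable {p : ℕ} {B : PolytopalBasis p}

theorem contDiff_onElement (c : NedelecCoeffs p M.m) (T : Fin M.m) {n : ℕ∞ω} :
    ContDiff ℝ n (c.onElement B M T) := by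
  have h : ∀ (a : ℝ) (r : MvPolynomial (Fin 2) ℝ) (l : Plane),
      ContDiff ℝ n fun ξ => (a * polyEval r ξ) • l := fun a r l =>
    (contDiff_const.mul (contDiff_polyEval r)).smul contDiff_const
  unfold NedelecCoeffs.onElement
  refine (ContDiff.sum fun e _ => (((ContDiff.sum fun l _ => h _ _ _).add
    (ContDiff.sum fun l _ => h _ _ _)).add
    (ContDiff.sum fun k _ => ContDiff.sum fun l _ => h _ _ _)).add
    (ContDiff.sum fun k _ => ContDiff.sum fun l _ => h _ _ _)).add
    (ContDiff.sum fun k _ => ContDiff.sum fun l _ => h _ _ _)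

/-- The rotation of a vector field. -/
noncomputable def rot (ϑ : Plane → Plane) (ξ : Plane) : ℝ :=
  partialD 0 (fun ξ => ϑ ξ 1) ξ - partialD 1 (fun ξ => ϑ ξ 0) ξ

theorem partialD_mul {F G : Plane → ℝ} {ξ : Plane} (hF : DifferentiableAt ℝ F ξ)
    (hG : DifferentiableAt ℝ G ξ) (i : Fin 2) :
    partialD i (fun ξ => F ξ * G ξ) ξ = F ξ * partialD i G ξ + partialD i F ξ * G ξ := by
  simp only [partialD]
  change (fderiv ℝ (F * G) ξ) _ = _
  rw [fderiv_mul hF hG]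
  simp [mul_comm]

/-- Integration by parts on the reference triangle. -/
theorem integral_cross_grad {ϑ : Plane → Plane} (hϑ : ContDiff ℝ 1 ϑ) {ψ : Plane → ℝ}
    (hψ : ∀ ξ ∈ refTriangle, ContDiffAt ℝ 1 ψ ξ) :
    ∫ ξ in refTriangle, (ϑ ξ 0 * partialD 1 ψ ξ - ϑ ξ 1 * partialD 0 ψ ξ) =
      (∫ t in (0 : ℝ)..1, ∑ e, (edgeSign e : ℝ) *
        (inner ℝ (refTangent e) (ϑ (edgeParam e t)) * ψ (edgeParam e t))) +
      ∫ ξ in refTriangle, rot ϑ ξ * ψ ξ := by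
  have hϑi : ∀ i, ContDiff ℝ 1 fun ξ => ϑ ξ i := fun i =>
    (EuclideanSpace.proj i : Plane →L[ℝ] ℝ).contDiff.comp hϑ
  have hprod : ∀ i, ∀ ξ ∈ refTriangle, ContDiffAt ℝ 1 (fun ξ => ϑ ξ i * ψ ξ) ξ := fun i ξ hξ =>
    (hϑi i).contDiffAt.mul (hψ ξ hξ)
  have hψc : ContinuousOn ψ refTriangle := fun ξ hξ =>
    (hψ ξ hξ).continuousAt.continuousWithinAt
  have hrot : ContinuousOn (rot ϑ) refTriangle :=
    (continuousOn_partialD (fun ξ _ => (hϑi 1).contDiffAt) 0).sub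
      (continuousOn_partialD (fun ξ _ => (hϑi 0).contDiffAt) 1)
  have h1 : IntegrableOn (fun ξ => partialD 1 (fun ξ => ϑ ξ 0 * ψ ξ) ξ -
      partialD 0 (fun ξ => ϑ ξ 1 * ψ ξ) ξ) refTriangle :=
    ((continuousOn_partialD (hprod 0) 1).sub
      (continuousOn_partialD (hprod 1) 0)).integrableOn_compact isCompact_refTriangle
  have h2 : IntegrableOn (fun ξ => rot ϑ ξ * ψ ξ) refTriangle :=
    (hrot.mul hψc).integrableOn_compact isCompact_refTriangle
  have hgreen := integral_rot_refTriangle (hprod 0) (hprod 1)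
  have hb : ∀ t e, (edgeSign e : ℝ) * (inner ℝ (refTangent e) (ϑ (edgeParam e t)) *
      ψ (edgeParam e t)) = (edgeSign e : ℝ) * (ϑ (edgeParam e t) 0 * ψ (edgeParam e t) *
        refTangent e 0 + ϑ (edgeParam e t) 1 * ψ (edgeParam e t) * refTangent e 1) := by
    intro t e
    rw [inner_plane]
    ring
  simp only [hb]
  rw [← hgreen, ← integral_add h1 h2]
  refine setIntegral_congr_fun isClosed_refTriangle.measurableSet fun ξ hξ => ?_
  have hd : ∀ i, DifferentiableAt ℝ (fun ξ => ϑ ξ i) ξ := fun i =>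
    (hϑi i).differentiable one_ne_zero ξ
  have hψd : DifferentiableAt ℝ ψ ξ := (hψ ξ hξ).differentiableAt one_ne_zero
  change _ = partialD 1 (fun ξ => ϑ ξ 0 * ψ ξ) ξ - partialD 0 (fun ξ => ϑ ξ 1 * ψ ξ) ξ +
    rot ϑ ξ * ψ ξ
  rw [partialD_mul (hd 0) hψd, partialD_mul (hd 1) hψd, rot]
  ring

/-- The contributions of the element edges through a given point cancel. -/
theorem IsH1Conforming.sum_boundary_eq_zero (hB : IsH1Conforming B) (c : NedelecCoeffs p M.m)
    {s : Fin M.m → ℝ} (hs1 : ∀ T, s T * s T = 1)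
    (hs : ∀ T, ∀ ξ ∈ refTriangle, |(fderiv ℝ (M.map T) ξ).det| = s T * (fderiv ℝ (M.map T) ξ).det)
    {φ : Plane → ℝ} (hφ : ∀ y ∉ A, φ y = 0) {t : ℝ} (ht : t ∈ Ioo (0 : ℝ) 1) :
    ∑ T, s T * ∑ e, (edgeSign e : ℝ) *
      (inner ℝ (refTangent e) (c.onElement B M T (edgeParam e t)) *
        φ (M.map T (edgeParam e t))) = 0 := by
  have ht' := Ioo_subset_Icc_self ht
  simp only [Finset.mul_sum]
  rw [← Fintype.sum_prod_type' (f := fun T e => s T * ((edgeSign e : ℝ) *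
      (inner ℝ (refTangent e) (c.onElement B M T (edgeParam e t)) *
        φ (M.map T (edgeParam e t)))))]
  set w : Fin M.m × Fin 3 → ℝ := fun i => s i.1 * edgeSign i.2 with hw
  have hw1 : ∀ i, w i * w i = 1 := fun i => by
    have h1 := hs1 i.1
    have h2 := edgeSign_mul_self i.2
    simp only [hw]
    linear_combination h1 * (edgeSign i.2 : ℝ) ^ 2 + h2
  have hratio : ∀ i j : Fin M.m × Fin 3, M.edgeRatio i.1 i.2 j.1 j.2 t < 0 → w i = - w j := by
    intro i j h
    have hi := hs i.1 _ (edgeParam_mem_refTriangle i.2 ht')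
    have hj := hs j.1 _ (edgeParam_mem_refTriangle j.2 ht')
    have hi0 := abs_pos.2
      ((M.isElementMap i.1).det_ne_zero _ (edgeParam_mem_refTriangle i.2 ht'))
    have hj0 := abs_pos.2
      ((M.isElementMap j.1).det_ne_zero _ (edgeParam_mem_refTriangle j.2 ht'))
    have hdi : (fderiv ℝ (M.map i.1) (edgeParam i.2 t)).det =
        s i.1 * |(fderiv ℝ (M.map i.1) (edgeParam i.2 t)).det| := by
      rw [hi, ← mul_assoc, hs1, one_mul]
    have hdj : (fderiv ℝ (M.map j.1) (edgeParam j.2 t)).det =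
        s j.1 * |(fderiv ℝ (M.map j.1) (edgeParam j.2 t)).det| := by
      rw [hj, ← mul_assoc, hs1, one_mul]
    have hsj : s j.1 ≠ 0 := fun h0 => by have := hs1 j.1; simp [h0] at this
    have heq : M.edgeRatio i.1 i.2 j.1 j.2 t = w i * w j *
        (|(fderiv ℝ (M.map i.1) (edgeParam i.2 t)).det| /
          |(fderiv ℝ (M.map j.1) (edgeParam j.2 t)).det|) := by
      rw [Triangulation.edgeRatio, div_eq_iff
        ((M.isElementMap j.1).det_ne_zero _ (edgeParam_mem_refTriangle j.2 ht')), hdj, hdi]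
      rw [abs_mul, abs_mul, abs_abs, abs_abs]
      have h1 : ∀ T, |s T| = 1 := fun T => by
        rcases mul_self_eq_one_iff.1 (hs1 T) with h | h <;> simp [h]
      rw [h1, h1, one_mul, one_mul]
      simp only [hw]
      field_simp
      linear_combination (-(s i.1 * edgeSign i.2 * edgeSign j.2 : ℝ)) * hs1 j.1
    rw [heq] at h
    have hneg : w i * w j < 0 := by
      by_contra! h0
      exact absurd h (not_lt.2 (mul_nonneg h0 (by positivity)))
    rcases mul_self_eq_mul_self_iff.1 ((hw1 i).trans (hw1 j).symm) with h1 | h1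
    · rw [h1, hw1] at hneg
      exact absurd hneg (by norm_num)
    · exact h1
  refine sum_eq_zero_of_partner
    (P := fun i j => M.SameEdge i.1 i.2 j.1 j.2 ∧ w i = - w j) ?_ ?_ ?_ ?_
  · rintro ⟨T, e⟩ h
    have hA : M.map T (edgeParam e t) ∈ A := by
      by_contra hA
      exact h (by simp [hφ _ hA])
    obtain ⟨T', e', hE, hr⟩ := M.exists_neighbour T e ht hA
    exact ⟨(T', e'), hE, hratio (T, e) (T', e') hr⟩
  · rintro i j ⟨hE, h⟩
    exact ⟨hE.symm, by rw [h, neg_neg]⟩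
  · rintro i ⟨T, e⟩ ⟨T', e'⟩ ⟨hE, h⟩ ⟨hE', h'⟩
    have hEE := hE.symm.trans hE'
    have hww : w (T, e) = w (T', e') := by linarith
    have hTT : T = T' := by
      by_contra hT
      have h1 := hratio (T, e) (T', e') (hEE.edgeRatio_neg hT ht)
      have h2 := hw1 (T, e)
      have h3 : w (T, e) = 0 := by linarith
      simp [h3] at h2
    subst hTT
    exact Prod.ext rfl hEE.eq
  · rintro ⟨T, e⟩ ⟨T', e'⟩ ⟨hE, h⟩
    have h : s T * edgeSign e = - (s T' * edgeSign e') := h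
    have h1 := hB.inner_onElement_eq hE c ht'
    have h2 := hE.map_eq ht'
    change s T * ((edgeSign e : ℝ) * _) + s T' * ((edgeSign e' : ℝ) * _) = 0
    dsimp only at hE h1 h2
    rw [h1, h2]
    linear_combination (inner ℝ (refTangent e') (c.onElement B M T' (edgeParam e' t)) *
      φ (M.map T' (edgeParam e' t))) * h

theorem IsH1Conforming.isHcurlConforming (hB : IsH1Conforming B) : IsHcurlConforming B := by
  intro A M c θ hθ
  have hpc : ∀ T, ContinuousOn (covariantPiola (M.map T) (c.onElement B M T)) refTriangle :=
    fun T => (M.isElementMap T).continuousOn_covariantPiola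
      (contDiff_onElement (n := 0) c T).continuous
  have hcd : ∀ T, ContDiff ℝ 1 (c.onElement B M T) := fun T => contDiff_onElement c T
  refine ⟨M.memLp_of_cells (M.memLp_cells hpc hθ), ?_⟩
  obtain ⟨g, hg⟩ := M.exists_piecewise
    fun T ξ => rot (c.onElement B M T) ξ / (fderiv ℝ (M.map T) ξ).det
  have hrot : ∀ T, ContinuousOn (rot (c.onElement B M T)) refTriangle := by
    intro T
    have hi : ∀ i, ContDiff ℝ 1 fun ξ => c.onElement B M T ξ i := fun i =>
      (EuclideanSpace.proj i : Plane →L[ℝ] ℝ).contDiff.comp (hcd T)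
    exact (continuousOn_partialD (fun ξ _ => (hi 1).contDiffAt) 0).sub
      (continuousOn_partialD (fun ξ _ => (hi 0).contDiffAt) 1)
  have hgL := M.memLp_cells (fun T => (hrot T).div
    (ContinuousLinearMap.continuous_det.comp_continuousOn (M.isElementMap T).continuousOn_fderiv)
    fun ξ hξ => (M.isElementMap T).det_ne_zero ξ hξ) hg
  refine ⟨g, M.memLp_of_cells hgL, ?_⟩
  rintro φ ⟨hφ, hφc, hφA⟩
  have hθi : ∀ i, MemLp (fun y => θ y i) 2 (volume.restrict M.cells) := fun i =>
    M.memLp_cells (fun T => (EuclideanSpace.proj i : Plane →L[ℝ] ℝ).continuous.comp_continuousOn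
      (hpc T)) fun T ξ hξ => by rw [hθ T ξ hξ]; rfl
  have hDφ : ∀ i, MemLp (partialD i φ) 2 (volume.restrict M.cells) := fun i =>
    Continuous.memLp_of_hasCompactSupport
      ((hφ.continuous_fderiv (by simp)).clm_apply continuous_const) (hφc.fderiv_apply ℝ _)
  have hint : ∀ i j, IntegrableOn (fun y => θ y i * partialD j φ y) M.cells := fun i j =>
    (hθi i).integrable_mul (q := 2) (hDφ j)
  have hint' : IntegrableOn (fun y => g y * φ y) M.cells :=
    hgL.integrable_mul (q := 2) (hφ.continuous.memLp_of_hasCompactSupport hφc)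
  have hout : ∀ y ∉ A, φ y = 0 := fun y hy =>
    image_eq_zero_of_notMem_tsupport fun h => hy (hφA h)
  have hout' : ∀ i, ∀ y ∉ A, partialD i φ y = 0 := fun i y hy => by
    have : fderiv ℝ φ y = 0 :=
      image_eq_zero_of_notMem_tsupport fun h => hy (hφA (tsupport_fderiv_subset ℝ h))
    simp [partialD, this]
  choose s hs1 hs using fun T => (M.isElementMap T).exists_sign
  rw [M.setIntegral_eq_sum (H := fun y => θ y 0 * partialD 1 φ y - θ y 1 * partialD 0 φ y)
    (fun y hy => by simp [hout' _ y hy]) ((hint 0 1).sub (hint 1 0)),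
    M.setIntegral_eq_sum (H := fun y => g y * φ y) (fun y hy => by simp [hout y hy]) hint']
  have hφx : ∀ T, ∀ ξ ∈ refTriangle, ContDiffAt ℝ 1 (φ ∘ M.map T) ξ := fun T ξ hξ =>
    (hφ.of_le (by simp)).contDiffAt.comp ξ ((M.isElementMap T).contDiffAt ξ hξ)
  have hae : refTriangle =ᵐ[volume] interior refTriangle :=
    (ae_le_set.2 volume_refTriangle_diff_interior).antisymm interior_subset.eventuallyLE
  have hleft : ∀ T, ∫ ξ in refTriangle, |(fderiv ℝ (M.map T) ξ).det| *
      (θ (M.map T ξ) 0 * partialD 1 φ (M.map T ξ) - θ (M.map T ξ) 1 * partialD 0 φ (M.map T ξ)) =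
      s T * ∫ ξ in refTriangle, (c.onElement B M T ξ 0 * partialD 1 (φ ∘ M.map T) ξ -
        c.onElement B M T ξ 1 * partialD 0 (φ ∘ M.map T) ξ) := by
    intro T
    rw [← integral_const_mul, setIntegral_congr_set hae, setIntegral_congr_set hae]
    refine setIntegral_congr_fun isOpen_interior.measurableSet fun ξ hξ => ?_
    have hξ' := interior_subset hξ
    dsimp only
    rw [← (M.isElementMap T).piola_cross_grad (hφ.differentiable (by simp)) hξ', hθ T ξ hξ,
      hs T ξ hξ', mul_assoc]
  have hright : ∀ T, ∫ ξ in refTriangle, |(fderiv ℝ (M.map T) ξ).det| *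
      (g (M.map T ξ) * φ (M.map T ξ)) =
      s T * ∫ ξ in refTriangle, rot (c.onElement B M T) ξ * (φ ∘ M.map T) ξ := by
    intro T
    rw [← integral_const_mul, setIntegral_congr_set hae, setIntegral_congr_set hae]
    refine setIntegral_congr_fun isOpen_interior.measurableSet fun ξ hξ => ?_
    have hξ' := interior_subset hξ
    have hd := (M.isElementMap T).det_ne_zero ξ hξ'
    rw [hg T ξ hξ, hs T ξ hξ', Function.comp_apply]
    field_simp
  simp only [hleft, hright]
  rw [← sub_eq_zero, ← Finset.sum_sub_distrib]
  have hdiff : ∀ T, s T * ∫ ξ in refTriangle, (c.onElement B M T ξ 0 *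
        partialD 1 (φ ∘ M.map T) ξ - c.onElement B M T ξ 1 * partialD 0 (φ ∘ M.map T) ξ) =
      (∫ t in (0 : ℝ)..1, s T * ∑ e, (edgeSign e : ℝ) *
        (inner ℝ (refTangent e) (c.onElement B M T (edgeParam e t)) *
          φ (M.map T (edgeParam e t)))) +
      s T * ∫ ξ in refTriangle, rot (c.onElement B M T) ξ * (φ ∘ M.map T) ξ := by
    intro T
    rw [integral_cross_grad (hcd T) (hφx T), mul_add, intervalIntegral.integral_const_mul]
    rfl
  simp only [hdiff, add_sub_cancel_right]
  rw [← intervalIntegral.integral_finsetSum]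
  · rw [intervalIntegral.integral_of_le zero_le_one, integral_Ioc_eq_integral_Ioo]
    exact setIntegral_eq_zero_of_forall_eq_zero fun t ht =>
      hB.sum_boundary_eq_zero c hs1 hs hout ht
  · intro T _
    refine ContinuousOn.intervalIntegrable ?_
    rw [uIcc_of_le zero_le_one]
    refine continuousOn_const.mul (continuousOn_finsetSum _ fun e _ => continuousOn_const.mul
      (ContinuousOn.mul ?_ ?_))
    · exact (continuous_const.inner
        ((hcd T).continuous.comp (continuous_edgeParam e))).continuousOn
    · exact hφ.continuous.comp_continuousOn ((M.isElementMap T).continuousOn.comp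
        (continuous_edgeParam e).continuousOn fun t ht => edgeParam_mem_refTriangle e ht)

end TriNedelec

theorem mainTheorem4 (p : ℕ) (hp : 1 ≤ p) (B : TriNedelec.PolytopalBasis p)
    (hB : TriNedelec.IsH1Conforming B) :
    (∀ e n ϑ, TriNedelec.IsNonCellFn B e n ϑ →
      -- on its own edge the tangential trace is the underlying scalar base function,
      (∀ ξ ∈ TriNedelec.refEdge e,
        inner ℝ (TriNedelec.refTangent e) (ϑ ξ) = TriNedelec.polyEval n ξ) ∧
      -- on the other edges it vanishes,
      (∀ e', e' ≠ e → ∀ ξ ∈ TriNedelec.refEdge e',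
        inner ℝ (TriNedelec.refTangent e') (ϑ ξ) = 0) ∧
      -- and both properties persist on every physical element.
      (∀ x, TriNedelec.IsElementMap x →
        (∀ ξ ∈ TriNedelec.refEdge e,
          inner ℝ (TriNedelec.physTangent x e ξ) (TriNedelec.covariantPiola x ϑ ξ)
            = TriNedelec.polyEval n ξ) ∧
        (∀ e', e' ≠ e → ∀ ξ ∈ TriNedelec.refEdge e',
          inner ℝ (TriNedelec.physTangent x e' ξ) (TriNedelec.covariantPiola x ϑ ξ) = 0))) ∧
    (∀ ϑ, TriNedelec.IsCellFn B ϑ → ∀ e, ∀ ξ ∈ TriNedelec.refEdge e,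
      inner ℝ (TriNedelec.refTangent e) (ϑ ξ) = 0 ∧
      ∀ x, TriNedelec.IsElementMap x →
        inner ℝ (TriNedelec.physTangent x e ξ) (TriNedelec.covariantPiola x ϑ ξ) = 0) ∧
    TriNedelec.HasContinuousTangentialTrace B ∧
    TriNedelec.IsHcurlConforming B := by
  refine ⟨fun e n ϑ h => ⟨fun ξ _ => h.inner_own ξ, fun e' he ξ hξ => h.inner_other he hξ,
    fun x hx => ⟨fun ξ hξ => ?_, fun e' he ξ hξ => ?_⟩⟩,
    fun ϑ h e ξ hξ => ⟨h.inner_eq_zero e hξ, fun x hx => ?_⟩,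
    hB.hasContinuousTangentialTrace, hB.isHcurlConforming⟩
  · rw [hx.inner_physTangent e ϑ (TriNedelec.refEdge_subset e hξ), h.inner_own]
  · rw [hx.inner_physTangent e' ϑ (TriNedelec.refEdge_subset e' hξ), h.inner_other he hξ]
  · rw [hx.inner_physTangent e ϑ (TriNedelec.refEdge_subset e hξ), h.inner_eq_zero e hξ]
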